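/- All posets are finite. The cover graph of a poset $P$ is the graph on the ground set of $P$ in which two elements are adjacent if one covers the other in $P$. The dimension $\dim(P)$ is the least size of a realizer of $P$, that is, of a set $\{\le_1,\dots,\le_n\}$ of linear orders on the ground set such that $x\le y$ in $P$ if and only if $x\le_i y$ for all $i$. For $k\ge 1$, the ladder $L_k$ is the graph with vertex set $\{1,2\}\times\{1,\dots,k\}$ in which $(i,j)$ and $(i',j')$ are adjacent if and only if $|i-i'|+|j-j'|=1$. A graph $H$ is a minor of a graph $G$ if one can assign to the vertices of $H$ pairwise vertex-disjoint connected (nonempty) subgraphs of $G$ such that for every edge $uv$ of $H$ there is an edge of $G$ between the subgraphs assigned to $u$ and $v$. A graph $H$ is unavoidable if there is an integer $D$ such that the cover graph of every poset of dimension at least $D$ contains $H$ as a minor. Corollary. For every integer $k\ge 1$ there exists an integer $d\ge 1$ such that every poset whose cover graph does not contain $L_k$ as a minor has dimension at most $d$. Consequently, for every $k\ge 1$ the ladder $L_k$ is unavoidable. -/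

import Mathlib

universe u v w

namespace PosetLadder

/-- An `H`-model in a graph `G`: each vertex of `H` is assigned a connected (in particular
nonempty) subgraph of `G`, distinct vertices get vertex-disjoint subgraphs, and for every edge
`x y` of `H` there is an edge of `G` between the subgraphs assigned to `x` and `y`. -/
structure IsModel {W : Type v} {V : Type w} (H : SimpleGraph W) (G : SimpleGraph V)
    (φ : W → G.Subgraph) : Prop where
  connected : ∀ x, (φ x).Connected
  disjoint : ∀ x y, x ≠ y → Disjoint (φ x).verts (φ y).verts
  adj : ∀ x y, H.Adj x y → ∃ a ∈ (φ x).verts, ∃ b ∈ (φ y).verts, G.Adj a b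

/-- `H` is a minor of `G`. -/
def IsMinor {W : Type v} {V : Type w} (H : SimpleGraph W) (G : SimpleGraph V) : Prop :=
  ∃ φ : W → G.Subgraph, IsModel H G φ

/-- The ladder with `k` rungs: the `2 × k` grid graph. -/
def ladder (k : ℕ) : SimpleGraph (Fin 2 × Fin k) where
  Adj p q := |((p.1 : ℕ) : ℤ) - ((q.1 : ℕ) : ℤ)| + |((p.2 : ℕ) : ℤ) - ((q.2 : ℕ) : ℤ)| = 1
  symm := ⟨fun p q h => by
    rw [abs_sub_comm ((q.1 : ℕ) : ℤ), abs_sub_comm ((q.2 : ℕ) : ℤ)]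
    exact h⟩
  loopless := ⟨fun p h => by simp at h⟩

/-- The binary relation `r` is a (non-strict) linear order. -/
structure IsLinear {P : Type u} (r : P → P → Prop) : Prop where
  refl : ∀ x, r x x
  trans : ∀ x y z, r x y → r y z → r x z
  antisymm : ∀ x y, r x y → r y x → x = y
  total : ∀ x y, r x y ∨ r y x

/-- A realizer of `P`: a set of linear orders on the ground set of `P` whose intersection is
the order of `P`. -/
structure IsRealizer (P : Type u) [PartialOrder P] (R : Set (P → P → Prop)) : Prop where
  linear : ∀ r ∈ R, IsLinear r
  le_iff : ∀ x y : P, x ≤ y ↔ ∀ r ∈ R, r x y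

/-- The dimension of a poset: the least size of a realizer. -/
noncomputable def dim (P : Type u) [PartialOrder P] : ℕ∞ :=
  sInf {n : ℕ∞ | ∃ R : Set (P → P → Prop), IsRealizer P R ∧ R.encard = n}

/-- A graph `H` is unavoidable if the cover graph of every (finite) poset of large enough
dimension contains `H` as a minor. The cover graph of `P` is `SimpleGraph.hasse P`. -/
def Unavoidable {W : Type v} (H : SimpleGraph W) : Prop :=
  ∃ D : ℕ, ∀ (P : Type u) [PartialOrder P] [Finite P],
    (D : ℕ∞) ≤ dim P → IsMinor H (SimpleGraph.hasse P)

end PosetLadder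

/-! Fix k and suppose that the cover graph has no ladder with k rungs as a minor. Two facts control
the dimension. If the parts of a poset outside the up-set and outside the down-set of one element
have dimension at most n, the whole has dimension at most 2n (`emb_of_delete`). If all 2-connected
convex pieces have dimension at most n ≥ 2, the whole has dimension at most n + 2 (`emb_of_blocks`).

Between these, a ladder rooted at a pair of elements is grown rung by rung. Let D be convex and
2-connected, with x ≠ y in D. Two disjoint paths with more than k² disjoint connections between them
contain a ladder, by Erdős–Szekeres (`isMinor_ladder_of_linked_paths`), so by Menger at most k²
vertices separate two disjoint x–y paths. This yields a set W of at most k² + 2 elements such that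
every connected subset of D missing W is avoided by some x–y connection (`TwoConn.exists_avoiding`).
Now let B be a 2-connected piece missing W. Two disjoint links from {x, y} to B extend the rails and
the avoiding connection supplies a rung, so a j-rung ladder in B rooted at the landing points
becomes a (j + 1)-rung ladder in D rooted at x, y (`TwoConn.exists_gain`).

Contrapositively, if D has no (j + 1)-rung ladder rooted at x, y, then each such B has no j-rung
ladder rooted at some pair. Induction bounds the dimension of B, assembling the pieces adds 2, and
restoring W multiplies by at most 2^(k² + 2); this is the recursion of `dimBound`. For j = k the
absence of rooted ladders is automatic, and one more use of `emb_of_blocks` reaches the whole poset.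
-/

namespace PosetLadder

/-! ### Connected vertex sets and components -/

section Connectivity

variable {V : Type*} {G H : SimpleGraph V} {A B C S T : Set V} {a b x y : V}

/-- The spanning subgraph of `G` that keeps the edges with both ends in `S`. -/
def restr (G : SimpleGraph V) (S : Set V) : SimpleGraph V where
  Adj a b := G.Adj a b ∧ a ∈ S ∧ b ∈ S
  symm := ⟨fun _ _ h => ⟨h.1.symm, h.2.2, h.2.1⟩⟩
  loopless := ⟨fun _ h => h.1.ne rfl⟩

/-- `S` is nonempty and induces a connected subgraph of `G`. -/
def SConn (G : SimpleGraph V) (S : Set V) : Prop :=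
  S.Nonempty ∧ ∀ x ∈ S, ∀ y ∈ S, (restr G S).Reachable x y

theorem restr_mono (hGH : G ≤ H) (h : S ⊆ T) : restr G S ≤ restr H T :=
  fun _ _ hab => ⟨hGH hab.1, h hab.2.1, h hab.2.2⟩

theorem reach_mono (h : S ⊆ T) (hab : (restr G S).Reachable a b) : (restr G T).Reachable a b :=
  hab.mono (restr_mono le_rfl h)

theorem mem_of_reach (hC : ∀ u v, G.Adj u v → u ∈ C → v ∈ C) (hab : G.Reachable a b)
    (ha : a ∈ C) : b ∈ C := by
  obtain ⟨p⟩ := hab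
  induction p with
  | nil => exact ha
  | cons h p ih => exact ih (hC _ _ h ha)

theorem exists_crossing (hab : G.Reachable a b) (ha : a ∈ C) (hb : b ∉ C) :
    ∃ u v, G.Adj u v ∧ u ∈ C ∧ v ∉ C := by
  by_contra! h
  exact hb (mem_of_reach h hab ha)

theorem mem_of_reach_restr (hab : (restr G S).Reachable a b) (ha : a ∈ S) : b ∈ S :=
  mem_of_reach (G := restr G S) (fun _ _ h _ => h.2.2) hab ha

theorem reach_of_adj (h : G.Adj a b) (ha : a ∈ S) (hb : b ∈ S) : (restr G S).Reachable a b :=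
  SimpleGraph.Adj.reachable ⟨h, ha, hb⟩

theorem sconn_of_forall_reach (ha : a ∈ S) (h : ∀ z ∈ S, (restr G S).Reachable a z) :
    SConn G S :=
  ⟨⟨a, ha⟩, fun x hx y hy => (h x hx).symm.trans (h y hy)⟩

theorem SConn.mono (hGH : G ≤ H) (h : SConn G S) : SConn H S :=
  ⟨h.1, fun x hx y hy => (h.2 x hx y hy).mono (restr_mono hGH le_rfl)⟩

theorem sconn_singleton : SConn G {a} :=
  sconn_of_forall_reach rfl (by rintro z rfl; exact SimpleGraph.Reachable.refl _)

/-- The component of `a` in the subgraph induced by `S`. -/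
def comp (G : SimpleGraph V) (S : Set V) (a : V) : Set V := {z | (restr G S).Reachable a z}

theorem mem_comp_self : a ∈ comp G S a := SimpleGraph.Reachable.refl _

theorem comp_subset (ha : a ∈ S) : comp G S a ⊆ S := fun _ hz => mem_of_reach_restr hz ha

theorem mem_comp_of_adj (hx : x ∈ comp G S a) (hxS : x ∈ S) (hy : y ∈ S) (h : G.Adj x y) :
    y ∈ comp G S a :=
  SimpleGraph.Reachable.trans hx (reach_of_adj h hxS hy)

theorem sconn_comp : SConn G (comp G S a) := by
  refine sconn_of_forall_reach (a := a) mem_comp_self fun z hz => ?_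
  have : z ∈ {w | w ∈ comp G S a ∧ (restr G (comp G S a)).Reachable a w} := by
    refine mem_of_reach (G := restr G S) (a := a) ?_ hz ⟨mem_comp_self, .refl _⟩
    rintro p q h ⟨hp, hpr⟩
    have hq : q ∈ comp G S a := mem_comp_of_adj hp h.2.1 h.2.2 h.1
    exact ⟨hq, hpr.trans (reach_of_adj h.1 hp hq)⟩
  exact this.2

theorem SConn.subset_comp (hT : SConn G T) (hTS : T ⊆ S) (ha : a ∈ T) : T ⊆ comp G S a :=
  fun z hz => reach_mono hTS (hT.2 a ha z hz)

theorem SConn.union (hS : SConn G S) (hT : SConn G T) (h : (S ∩ T).Nonempty) :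
    SConn G (S ∪ T) := by
  obtain ⟨c, hcS, hcT⟩ := h
  refine sconn_of_forall_reach (Or.inl hcS) ?_
  rintro z (hz | hz)
  · exact reach_mono Set.subset_union_left (hS.2 c hcS z hz)
  · exact reach_mono Set.subset_union_right (hT.2 c hcT z hz)

theorem sconn_pair (h : G.Adj a b) : SConn G {a, b} := by
  refine sconn_of_forall_reach (a := a) (by simp) ?_
  rintro z (rfl | rfl)
  · exact .refl _
  · exact reach_of_adj h (by simp) (by simp)

theorem SConn.union_of_adj (hS : SConn G S) (hT : SConn G T) (ha : a ∈ S) (hb : b ∈ T)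
    (h : G.Adj a b) : SConn G (S ∪ T) := by
  have h1 := (hS.union (sconn_pair h) ⟨a, ha, by simp⟩).union hT ⟨b, by simp, hb⟩
  convert h1 using 1
  ext z
  simp only [Set.mem_union, Set.mem_insert_iff, Set.mem_singleton_iff]
  constructor
  · tauto
  · rintro ((h | rfl | rfl) | h) <;> tauto

/-- If a connected set meets both `T` and its complement, an edge inside it leaves `T`. -/
theorem SConn.exists_crossing (hS : SConn G S) (ha : a ∈ S) (haT : a ∈ T) (hb : b ∈ S)
    (hbT : b ∉ T) : ∃ u v, G.Adj u v ∧ u ∈ S ∧ v ∈ S ∧ u ∈ T ∧ v ∉ T := by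
  obtain ⟨u, v, h, hu, hv⟩ := PosetLadder.exists_crossing (hS.2 a ha b hb) haT hbT
  exact ⟨u, v, h.1, h.2.1, h.2.2, hu, hv⟩

/-- Stop at the first arrival at x: the component of a in C without x, together with x, does the
job. It replaces a path ending at x in the proof of Menger's theorem. -/
theorem SConn.exists_path_to (hC : SConn G C) (ha : a ∈ C) (hx : x ∈ C) :
    ∃ D ⊆ C, SConn G D ∧ a ∈ D ∧ x ∈ D ∧ ∀ z ∈ D, z ≠ x → (restr G (C \ {x})).Reachable a z := by
  by_cases hax : a = x
  · subst hax
    exact ⟨{a}, by simpa using ha, sconn_singleton, rfl, rfl, fun z hz h => absurd hz h⟩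
  · have haC : a ∈ C \ {x} := ⟨ha, hax⟩
    have hK : comp G (C \ {x}) a ⊆ C \ {x} := comp_subset haC
    obtain ⟨p, q, hpq, hp, hq, hpK, hqK⟩ :=
      hC.exists_crossing ha (mem_comp_self (G := G) (S := C \ {x})) hx (fun h => (hK h).2 rfl)
    have hqx : q = x := by
      by_contra hne
      exact hqK (mem_comp_of_adj hpK (hK hpK) ⟨hq, hne⟩ hpq)
    subst hqx
    refine ⟨comp G (C \ {q}) a ∪ {q}, ?_, ?_, Or.inl mem_comp_self, Or.inr rfl, ?_⟩
    · rintro z (hz | rfl)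
      · exact (hK hz).1
      · exact hx
    · exact sconn_comp.union_of_adj sconn_singleton hpK rfl hpq
    · rintro z (hz | hz) hne
      · exact hz
      · exact absurd hz hne

end Connectivity

/-! ### Menger's theorem for disjoint connected sets -/

section Menger

variable {V : Type*} {G H : SimpleGraph V} {A B C S T : Set V} {a b x y : V} {n : ℕ}

/-- There are `n` pairwise disjoint connected sets each of which meets both `A` and `B`. -/
def Linked (G : SimpleGraph V) (n : ℕ) (A B : Set V) : Prop :=
  ∃ C : Fin n → Set V, (∀ i, SConn G (C i)) ∧ (∀ i, (A ∩ C i).Nonempty) ∧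
    (∀ i, (B ∩ C i).Nonempty) ∧ ∀ i j, i ≠ j → Disjoint (C i) (C j)

/-- No set of fewer than `n` vertices separates `A` from `B`. -/
def Unseparated (G : SimpleGraph V) (n : ℕ) (A B : Set V) : Prop :=
  ∀ X : Finset V, X.card < n →
    ∃ a ∈ A, ∃ b ∈ B, a ∉ X ∧ b ∉ X ∧ (restr G {z | z ∉ X}).Reachable a b

theorem Unseparated.symm (h : Unseparated G n A B) : Unseparated G n B A := by
  intro X hX
  obtain ⟨a, ha, b, hb, haX, hbX, hab⟩ := h X hX
  exact ⟨b, hb, a, ha, hbX, haX, hab.symm⟩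

/-- If `n` disjoint connected sets meet both `A` and a set `T` of at most `n` vertices, then they
can be labelled by the elements of `T` and cut down so that each reaches `T` only at its label. -/
theorem Linked.exists_fan [DecidableEq V] {T : Finset V} (hT : T.card ≤ n)
    (h : Linked G n A (T : Set V)) :
    T.card = n ∧ ∃ D : V → Set V, (∀ t ∈ T, SConn G (D t) ∧ t ∈ D t ∧ (A ∩ D t).Nonempty ∧
      ∀ z ∈ D t, z ≠ t → ∃ a ∈ A, a ∉ T ∧ (restr G {z | z ∉ T}).Reachable a z) ∧
      ∀ s ∈ T, ∀ t ∈ T, s ≠ t → Disjoint (D s) (D t) := by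
  obtain ⟨C, hC, hA, hTC, hd⟩ := h
  choose a haA haC using hA
  choose t htT htC using hTC
  have hinj : Function.Injective t := by
    intro i j hij
    by_contra hne
    exact Set.disjoint_left.1 (hd i j hne) (htC i) (hij ▸ htC j)
  have himg : Finset.univ.image t = T := by
    apply Finset.eq_of_subset_of_card_le
    · intro z hz
      obtain ⟨i, -, rfl⟩ := Finset.mem_image.1 hz
      exact htT i
    · rw [Finset.card_image_of_injective _ hinj]
      simpa using hT
  refine ⟨?_, ?_⟩
  · rw [← himg, Finset.card_image_of_injective _ hinj]
    simp
  have huniq : ∀ i, ∀ z ∈ C i, z ∈ T → z = t i := by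
    intro i z hz hzT
    rw [← himg] at hzT
    obtain ⟨j, -, rfl⟩ := Finset.mem_image.1 hzT
    by_contra hne
    have hij : j ≠ i := fun h => hne (by rw [h])
    exact Set.disjoint_left.1 (hd j i hij) (htC j) hz
  have key : ∀ s : V, ∃ D : Set V, s ∈ T → ((SConn G D ∧ s ∈ D ∧ (A ∩ D).Nonempty ∧
      ∀ z ∈ D, z ≠ s → ∃ a ∈ A, a ∉ T ∧ (restr G {z | z ∉ T}).Reachable a z) ∧
      ∃ i, t i = s ∧ D ⊆ C i) := by
    intro s
    by_cases hs : s ∈ T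
    swap
    · exact ⟨∅, fun h => absurd h hs⟩
    have hs' := hs
    rw [← himg] at hs'
    obtain ⟨i, -, rfl⟩ := Finset.mem_image.1 hs'
    obtain ⟨D, hDC, hD, haD, htD, hz⟩ := (hC i).exists_path_to (haC i) (htC i)
    refine ⟨D, fun _ => ⟨⟨hD, htD, ⟨a i, haA i, haD⟩, fun z hzD hne => ?_⟩, i, rfl, hDC⟩⟩
    have hr := hz z hzD hne
    have hai : a i ≠ t i := by
      rintro heq
      obtain ⟨p⟩ := hr
      cases p with
      | nil => exact hne heq
      | cons h p => exact h.2.1.2 heq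
    refine ⟨a i, haA i, fun h => hai (huniq i _ (haC i) h), reach_mono ?_ hr⟩
    rintro w ⟨hw, hwt⟩ hwT
    exact hwt (huniq i w hw hwT)
  choose D hD using key
  refine ⟨D, fun s hs => (hD s hs).1, fun s hs s' hs' hne => ?_⟩
  obtain ⟨-, i, rfl, hi⟩ := hD s hs
  obtain ⟨-, j, rfl, hj⟩ := hD s' hs'
  exact (hd i j fun h => hne (by rw [h])).mono hi hj

/-- Without edges, A ∩ B is itself a separator, so it has at least n elements, and singletons serve
as the links. -/
theorem linked_of_forall_not_adj [Finite V] (hG : ∀ a b, ¬ G.Adj a b)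
    (h : Unseparated G n A B) : Linked G n A B := by
  classical
  have := Fintype.ofFinite V
  let X : Finset V := Finset.univ.filter fun z => z ∈ A ∧ z ∈ B
  have hX : n ≤ X.card := by
    by_contra! hlt
    obtain ⟨a, ha, b, hb, haX, hbX, hab⟩ := h X hlt
    obtain ⟨p⟩ := hab
    cases p with
    | nil => exact haX (by simp [X, ha, hb])
    | cons h p => exact hG _ _ h.1
  obtain ⟨f⟩ : Nonempty (Fin n ↪ X) :=
    Function.Embedding.nonempty_of_card_le (by simpa using hX)
  have hf : ∀ i, (f i : V) ∈ A ∧ (f i : V) ∈ B := fun i => by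
    exact (Finset.mem_filter.1 (f i).2).2
  refine ⟨fun i => {(f i : V)}, fun i => sconn_singleton, fun i => ⟨f i, (hf i).1, rfl⟩,
    fun i => ⟨f i, (hf i).2, rfl⟩, fun i j hij => ?_⟩
  rw [Set.disjoint_singleton]
  exact fun h => hij (f.injective (Subtype.ext h))

/-- The inductive step of Menger's theorem, for an edge `x y` whose deletion leaves a separator
`S` of fewer than `n` vertices with `x` on the side of `A` and `y` on the side of `B`. -/
theorem unseparated_insert {x y : V} {S : Finset V} [DecidableEq V]
    (h : Unseparated G n A B)
    (hH : ∀ u v, G.Adj u v → H.Adj u v ∨ (u = x ∧ v = y) ∨ (u = y ∧ v = x))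
    {RA RB : Set V} (hd : Disjoint RA RB)
    (hRA : ∀ a ∈ A, a ∉ S → comp H {z | z ∉ S} a ⊆ RA)
    (hRB : ∀ b ∈ B, b ∉ S → b ∈ RB)
    (hy : y ∉ RA) :
    Unseparated H n A (insert x S : Finset V) := by
  intro Y hY
  obtain ⟨a, ha, b, hb, haY, hbY, hab⟩ := h Y hY
  by_contra! hno
  -- If Y separated A from S ∪ {x} in H, the component of a in H − Y would stay inside RA and miss
  -- x. The edge x y could not leave it either, so it would contain b, which lies in RB.
  have hRS : ∀ z ∈ comp H {z | z ∉ Y} a, z ∉ insert x S := by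
    intro z hz hzS
    exact hno a ha z (by exact_mod_cast hzS) haY (mem_of_reach_restr hz haY) hz
  have hsub : comp H {z | z ∉ Y} a ⊆ RA := by
    have haS : a ∉ S := fun h => hRS a mem_comp_self (Finset.mem_insert_of_mem h)
    refine Set.Subset.trans ?_ (hRA a ha haS)
    exact sconn_comp.subset_comp
      (fun z hz hzS => hRS z hz (Finset.mem_insert_of_mem hzS)) mem_comp_self
  have hbR : b ∈ comp H {z | z ∉ Y} a := by
    refine mem_of_reach ?_ hab mem_comp_self
    rintro p q ⟨hpq, hp, hq⟩ hpR
    rcases hH p q hpq with h1 | ⟨rfl, rfl⟩ | ⟨rfl, rfl⟩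
    · exact mem_comp_of_adj hpR hp hq h1
    · exact absurd (Finset.mem_insert_self _ _) (hRS p hpR)
    · exact absurd (hsub hpR) hy
  have hbS : b ∉ S := fun h => hRS b hbR (Finset.mem_insert_of_mem h)
  exact Set.disjoint_left.1 hd (hsub hbR) (hRB b hb hbS)

/-- The fan from A stays in RA ∪ S and the fan from B in RB ∪ S, so they meet only in S. Members
with the same label in S are glued there, and the members labelled x and y are joined by the edge x
y; the map τ encodes this matching. -/
theorem linked_of_halves [DecidableEq V] {S : Finset V} (hS : S.card < n)
    (hHG : H ≤ G) (hxy : G.Adj x y) {RA RB : Set V} (hd : Disjoint RA RB)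
    (hRAS : ∀ z ∈ RA, z ∉ S) (hRBS : ∀ z ∈ RB, z ∉ S)
    (hRA : ∀ a ∈ A, a ∉ S → comp H {z | z ∉ S} a ⊆ RA)
    (hRB : ∀ b ∈ B, b ∉ S → comp H {z | z ∉ S} b ⊆ RB)
    (hx : x ∈ RA) (hy : y ∈ RB)
    (hA : Linked H n A (insert x S : Finset V)) (hB : Linked H n B (insert y S : Finset V)) :
    Linked G n A B := by
  obtain ⟨hcard, D, hD, hDD⟩ := hA.exists_fan ((Finset.card_insert_le _ _).trans hS)
  obtain ⟨-, E, hE, hEE⟩ := hB.exists_fan ((Finset.card_insert_le _ _).trans hS)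
  have hxS := hRAS x hx
  have hyS := hRBS y hy
  have hDR : ∀ t ∈ insert x S, ∀ z ∈ D t, z ∈ RA ∨ (z = t ∧ t ∈ S) := by
    intro t ht z hz
    by_cases hzt : z = t
    · subst hzt
      rcases Finset.mem_insert.1 ht with rfl | h
      · exact Or.inl hx
      · exact Or.inr ⟨rfl, h⟩
    · obtain ⟨a, ha, haS, hr⟩ := (hD t ht).2.2.2 z hz hzt
      left
      refine hRA a ha (fun h => haS (Finset.mem_insert_of_mem h)) ?_
      refine reach_mono ?_ hr
      exact fun w hw h => hw (Finset.mem_insert_of_mem h)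
  have hER : ∀ t ∈ insert y S, ∀ z ∈ E t, z ∈ RB ∨ (z = t ∧ t ∈ S) := by
    intro t ht z hz
    by_cases hzt : z = t
    · subst hzt
      rcases Finset.mem_insert.1 ht with rfl | h
      · exact Or.inl hy
      · exact Or.inr ⟨rfl, h⟩
    · obtain ⟨a, ha, haS, hr⟩ := (hE t ht).2.2.2 z hz hzt
      left
      refine hRB a ha (fun h => haS (Finset.mem_insert_of_mem h)) ?_
      refine reach_mono ?_ hr
      exact fun w hw h => hw (Finset.mem_insert_of_mem h)
  obtain ⟨e⟩ : Nonempty (Fin n ≃ (insert x S : Finset V)) :=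
    ⟨(Fintype.equivFinOfCardEq (by simpa using hcard)).symm⟩
  let τ : V → V := fun t => if t = x then y else t
  have hτx : τ x = y := if_pos rfl
  have hτS : ∀ t ∈ S, τ t = t := fun t ht =>
    if_neg (by rintro rfl; exact hxS ht)
  have hτ : ∀ t ∈ insert x S, τ t ∈ insert y S := by
    intro t ht
    rcases Finset.mem_insert.1 ht with rfl | h
    · rw [hτx]; exact Finset.mem_insert_self _ _
    · rw [hτS t h]; exact Finset.mem_insert_of_mem h
  have hτinj : ∀ s ∈ insert x S, ∀ t ∈ insert x S, s ≠ t → τ s ≠ τ t := by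
    intro s hs t ht hne
    rcases Finset.mem_insert.1 hs with rfl | hs' <;> rcases Finset.mem_insert.1 ht with rfl | ht'
    · exact absurd rfl hne
    · rw [hτx, hτS t ht']; rintro rfl; exact hyS ht'
    · rw [hτx, hτS s hs']; rintro rfl; exact hyS hs'
    · rwa [hτS s hs', hτS t ht']
  have hDE : ∀ s ∈ insert x S, ∀ t ∈ insert x S, s ≠ t → Disjoint (D s) (E (τ t)) := by
    intro s hs t ht hne
    rw [Set.disjoint_left]
    intro z hzD hzE
    rcases hDR s hs z hzD with h1 | ⟨rfl, h1⟩ <;> rcases hER _ (hτ t ht) z hzE with h2 | ⟨h2, h3⟩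
    · exact Set.disjoint_left.1 hd h1 h2
    · exact hRAS z h1 (h2 ▸ h3)
    · exact hRBS z h2 h1
    · rw [← hτS z h1] at h2
      exact hτinj _ hs t ht hne h2
  refine ⟨fun i => D (e i) ∪ E (τ (e i)), fun i => ?_, fun i => ?_, fun i => ?_,
    fun i j hij => ?_⟩
  · have h1 := (hD _ (e i).2).1.mono hHG
    have h2 := (hE _ (hτ _ (e i).2)).1.mono hHG
    have h3 := (hD _ (e i).2).2.1
    have h4 := (hE _ (hτ _ (e i).2)).2.1
    rcases Finset.mem_insert.1 (e i).2 with h | h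
    · refine h1.union_of_adj h2 h3 h4 ?_
      rw [h, hτx]
      exact hxy
    · refine h1.union h2 ⟨_, h3, ?_⟩
      have h5 := hτS _ h
      rwa [h5] at h4 ⊢
  · obtain ⟨a, ha, haD⟩ := (hD _ (e i).2).2.2.1
    exact ⟨a, ha, Or.inl haD⟩
  · obtain ⟨b, hb, hbE⟩ := (hE _ (hτ _ (e i).2)).2.2.1
    exact ⟨b, hb, Or.inr hbE⟩
  · have hne : (e i : V) ≠ e j := fun h => hij (e.injective (Subtype.ext h))
    rw [Set.disjoint_union_left, Set.disjoint_union_right, Set.disjoint_union_right]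
    exact ⟨⟨hDD _ (e i).2 _ (e j).2 hne, hDE _ (e i).2 _ (e j).2 hne⟩,
      (hDE _ (e j).2 _ (e i).2 hne.symm).symm,
      hEE _ (hτ _ (e i).2) _ (hτ _ (e j).2) (hτinj _ (e i).2 _ (e j).2 hne)⟩

/-- **Menger's theorem**: if no set of fewer than `n` vertices separates `A` from `B`, then there
are `n` disjoint connected sets meeting both `A` and `B`. -/
theorem menger [Finite V] : ∀ (G : SimpleGraph V) (A B : Set V),
    Unseparated G n A B → Linked G n A B := by
  classical
  suffices ∀ (m : ℕ) (G : SimpleGraph V), G.edgeSet.ncard = m → ∀ A B : Set V,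
      Unseparated G n A B → Linked G n A B from fun G => this _ G rfl
  intro m
  induction m using Nat.strong_induction_on with
  | _ m ih =>
  rintro G rfl A B h
  by_cases hE : ∀ a b, ¬ G.Adj a b
  · exact linked_of_forall_not_adj hE h
  push Not at hE
  obtain ⟨p, q, hpq⟩ := hE
  let H := G.deleteEdges {s(p, q)}
  have hHG : H ≤ G := SimpleGraph.deleteEdges_le _
  have hHadj : ∀ u v, G.Adj u v → H.Adj u v ∨ (u = p ∧ v = q) ∨ (u = q ∧ v = p) := by
    intro u v huv
    by_cases h' : s(u, v) = s(p, q)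
    · right
      simpa using h'
    · left
      rw [SimpleGraph.deleteEdges_adj]
      exact ⟨huv, h'⟩
  have hHm : H.edgeSet.ncard < G.edgeSet.ncard := by
    apply Set.ncard_lt_ncard _ (Set.toFinite _)
    rw [SimpleGraph.edgeSet_ssubset_edgeSet]
    refine lt_of_le_of_ne hHG fun heq => ?_
    have : H.Adj p q := heq ▸ hpq
    simp [H] at this
  replace ih := fun A B => ih _ hHm H rfl A B
  by_cases hH : Unseparated H n A B
  · obtain ⟨C, hC, hA, hB, hd⟩ := ih A B hH
    exact ⟨C, fun i => (hC i).mono hHG, hA, hB, hd⟩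
  unfold Unseparated at hH
  push Not at hH
  obtain ⟨S, hS, hsep⟩ := hH
  obtain ⟨a, ha, b, hb, haS, hbS, hab⟩ := h S hS
  let RA : Set V := {z | ∃ a ∈ A, a ∉ S ∧ z ∈ comp H {z | z ∉ S} a}
  let RB : Set V := {z | ∃ b ∈ B, b ∉ S ∧ z ∈ comp H {z | z ∉ S} b}
  have hd : Disjoint RA RB := by
    rw [Set.disjoint_left]
    rintro z ⟨a, ha, haS, hza⟩ ⟨b, hb, hbS, hzb⟩
    exact hsep a ha b hb haS hbS (SimpleGraph.Reachable.trans hza hzb.symm)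
  have hRAS : ∀ z ∈ RA, z ∉ S := by
    rintro z ⟨a, ha, haS, hza⟩
    exact comp_subset haS hza
  have hRBS : ∀ z ∈ RB, z ∉ S := by
    rintro z ⟨a, ha, haS, hza⟩
    exact comp_subset haS hza
  have hRA : ∀ a ∈ A, a ∉ S → comp H {z | z ∉ S} a ⊆ RA := fun a ha haS z hz => ⟨a, ha, haS, hz⟩
  have hRB : ∀ b ∈ B, b ∉ S → comp H {z | z ∉ S} b ⊆ RB := fun a ha haS z hz => ⟨a, ha, haS, hz⟩
  have hclA : ∀ u v, H.Adj u v → u ∈ RA → v ∉ S → v ∈ RA := by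
    rintro u v huv hu hv
    have hu' := hRAS u hu
    obtain ⟨a, ha, haS, hua⟩ := hu
    exact ⟨a, ha, haS, mem_comp_of_adj hua hu' hv huv⟩
  have hclB : ∀ u v, H.Adj u v → u ∈ RB → v ∉ S → v ∈ RB := by
    rintro u v huv hu hv
    have hu' := hRBS u hu
    obtain ⟨a, ha, haS, hua⟩ := hu
    exact ⟨a, ha, haS, mem_comp_of_adj hua hu' hv huv⟩
  have haRA : a ∈ RA := ⟨a, ha, haS, mem_comp_self⟩
  have hbRB : b ∈ RB := ⟨b, hb, hbS, mem_comp_self⟩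
  -- The connection from a to b outside S exists in G but not in H, so it can leave RA only through
  -- the deleted edge. Read backwards from b, it shows that the other end lies in RB.
  obtain ⟨x, y, hxy, hx, hy⟩ := exists_crossing hab haRA
    (fun h => Set.disjoint_left.1 hd h hbRB)
  obtain ⟨y', x', hyx', hy', hx'⟩ := exists_crossing hab.symm hbRB
    (Set.disjoint_left.1 hd haRA)
  have hedge : ∀ u v, H.Adj u v ∨ (u = x ∧ v = y) ∨ (u = y ∧ v = x) ∨ ¬ G.Adj u v := by
    intro u v
    by_cases huv : G.Adj u v
    · rcases hHadj x y hxy.1 with h1 | h1 | h1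
      · exact absurd (hclA x y h1 hx hxy.2.2) hy
      all_goals
        obtain ⟨rfl, rfl⟩ := h1
        have := hHadj u v huv
        tauto
    · tauto
  have hyRB : y ∈ RB := by
    rcases hedge y' x' with h1 | ⟨rfl, rfl⟩ | ⟨rfl, rfl⟩ | h1
    · exact absurd (hclB _ _ h1 hy' hyx'.2.2) hx'
    · exact absurd hy' (Set.disjoint_left.1 hd hx)
    · exact hy'
    · exact absurd hyx'.1 h1
  have hxRB : x ∉ RB := Set.disjoint_left.1 hd hx
  have hA : Linked H n A (insert x S : Finset V) := by
    refine ih _ _ (unseparated_insert (x := x) (y := y) h ?_ hd hRA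
      (fun b hb hbS => ⟨b, hb, hbS, mem_comp_self⟩) hy)
    intro u v huv
    have := hedge u v
    tauto
  have hB : Linked H n B (insert y S : Finset V) := by
    refine ih _ _ (unseparated_insert (x := y) (y := x) h.symm ?_ hd.symm hRB
      (fun b hb hbS => ⟨b, hb, hbS, mem_comp_self⟩) hxRB)
    intro u v huv
    have := hedge u v
    tauto
  exact linked_of_halves hS hHG hxy.1 hd hRAS hRBS hRA hRB hx hyRB hA hB

end Menger

/-! ### The Erdős–Szekeres theorem -/

section ErdosSzekeres

variable {ι : Type*} {α β : ι → ℕ}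

/-- Peel off the minimal elements M of the product order: they form a decreasing family. If M has at
most s elements, the rest contains an increasing family by induction, and an element of I strictly
below its least member extends it. -/
theorem erdos_szekeres [DecidableEq ι] (s : ℕ) : ∀ (r : ℕ) (I : Finset ι),
    Set.InjOn α I → Set.InjOn β I → r * s < I.card →
    (∃ C ⊆ I, C.card = r + 1 ∧ ∀ i ∈ C, ∀ j ∈ C, α i < α j → β i < β j) ∨
      ∃ C ⊆ I, C.card = s + 1 ∧ ∀ i ∈ C, ∀ j ∈ C, α i < α j → β j < β i := by
  intro r
  induction r with
  | zero =>
    intro I _ _ hI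
    obtain ⟨C, hC, hC1⟩ := Finset.exists_subset_card_eq (s := I) (n := 1) (by omega)
    obtain ⟨c, rfl⟩ := Finset.card_eq_one.1 hC1
    refine Or.inl ⟨_, hC, by simp, ?_⟩
    simp
  | succ r ih =>
    intro I hα hβ hI
    let M := I.filter fun i => ∀ j ∈ I, ¬ (α j < α i ∧ β j < β i)
    by_cases hM : s < M.card
    · obtain ⟨C, hC, hC1⟩ := Finset.exists_subset_card_eq (s := M) (n := s + 1) hM
      refine Or.inr ⟨C, hC.trans (Finset.filter_subset _ _), hC1, fun i hi j hj hij => ?_⟩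
      have hiI := (Finset.mem_filter.1 (hC hi)).1
      have hjM := Finset.mem_filter.1 (hC hj)
      have h1 : ¬ β i < β j := fun h => hjM.2 i hiI ⟨hij, h⟩
      have h2 : β i ≠ β j := fun h => hij.ne (by rw [hβ hiI hjM.1 h])
      omega
    · have hcard : r * s < (I \ M).card := by
        rw [Finset.card_sdiff_of_subset (Finset.filter_subset _ _)]
        change r * s < I.card - M.card
        have : (r + 1) * s = r * s + s := by ring
        omega
      have hsub : I \ M ⊆ I := Finset.sdiff_subset
      have hsub' : ((I \ M : Finset ι) : Set ι) ⊆ I := by exact_mod_cast hsub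
      rcases ih (I \ M) (hα.mono hsub') (hβ.mono hsub') hcard with
        ⟨C, hC, hC1, h⟩ | ⟨C, hC, hC1, h⟩
      · obtain ⟨c, hc, hmin⟩ := C.exists_min_image α (Finset.card_pos.1 (by omega))
        have hcI := hC hc
        obtain ⟨d, hd, hdα, hdβ⟩ : ∃ d ∈ I, α d < α c ∧ β d < β c := by
          by_contra! hno
          refine (Finset.mem_sdiff.1 hcI).2 (Finset.mem_filter.2 ⟨hsub hcI, ?_⟩)
          rintro j hj ⟨h1, h2⟩
          exact absurd h2 (not_lt.2 (hno j hj h1))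
        have hdmin : ∀ i ∈ C, α d < α i := fun i hi => hdα.trans_le (hmin i hi)
        have hβc : ∀ i ∈ C, β d < β i := by
          intro i hi
          rcases (hmin i hi).lt_or_eq with h1 | h1
          · exact hdβ.trans (h c hc i hi h1)
          · rwa [← hα (hsub hcI) (hsub (hC hi)) h1]
        refine Or.inl ⟨insert d C, ?_, ?_, ?_⟩
        · exact Finset.insert_subset hd (hC.trans hsub)
        · rw [Finset.card_insert_of_notMem fun h => (hdmin d h).false, hC1]
        · intro i hi j hj hij
          rcases Finset.mem_insert.1 hi with rfl | hiC <;>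
            rcases Finset.mem_insert.1 hj with rfl | hjC
          · exact absurd hij (lt_irrefl _)
          · exact hβc j hjC
          · exact absurd (hdmin i hiC) hij.not_gt
          · exact h i hiC j hjC hij
      · exact Or.inr ⟨C, hC.trans hsub, hC1, h⟩

/-- A finite set on which `α` is injective can be enumerated with `α` increasing. -/
theorem exists_enumeration {C : Finset ι} {k : ℕ} (hC : C.card = k + 1) (hα : Set.InjOn α C) :
    ∃ f : ℕ → ι, (∀ t, f t ∈ C) ∧ ∀ s t, s < t → t ≤ k → α (f s) < α (f t) := by
  classical
  have hcard : (C.image α).card = k + 1 := by rw [Finset.card_image_of_injOn hα, hC]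
  let e := (C.image α).orderEmbOfFin hcard
  have he : ∀ t, ∃ i ∈ C, α i = e t := fun t =>
    Finset.mem_image.1 ((C.image α).orderEmbOfFin_mem hcard t)
  choose g hgC hg using he
  -- Indices beyond k are clamped to k; only t ≤ k matters.
  refine ⟨fun t => g ⟨min t k, by omega⟩, fun t => hgC _, fun s t hst ht => ?_⟩
  rw [hg, hg]
  exact e.strictMono (by rw [Fin.mk_lt_mk]; omega)

end ErdosSzekeres

/-! ### Ladders from two linked paths -/

section Ladder

variable {V : Type*} {G : SimpleGraph V} {A B C D S T : Set V} {a b x y : V} {k n : ℕ}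

/-- There is an edge of `G` between `S` and `T`. -/
def Touch (G : SimpleGraph V) (S T : Set V) : Prop := ∃ a ∈ S, ∃ b ∈ T, G.Adj a b

theorem Touch.symm (h : Touch G S T) : Touch G T S := by
  obtain ⟨a, ha, b, hb, hab⟩ := h
  exact ⟨b, hb, a, ha, hab.symm⟩

theorem Touch.mono (h : Touch G S T) (hA : S ⊆ A) (hB : T ⊆ B) : Touch G A B := by
  obtain ⟨a, ha, b, hb, hab⟩ := h
  exact ⟨a, hA ha, b, hB hb, hab⟩

/-- The sets `S 0, …, S (k - 1)` and `T 0, …, T (k - 1)` are the branch sets of the two rails of a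
ladder with `k` rungs. -/
structure LadderSets (G : SimpleGraph V) (k : ℕ) (S T : ℕ → Set V) : Prop where
  connS : ∀ j < k, SConn G (S j)
  connT : ∀ j < k, SConn G (T j)
  rung : ∀ j < k, Touch G (S j) (T j)
  railS : ∀ j, j + 1 < k → Touch G (S j) (S (j + 1))
  railT : ∀ j, j + 1 < k → Touch G (T j) (T (j + 1))
  disjS : ∀ i j, i < j → j < k → Disjoint (S i) (S j)
  disjT : ∀ i j, i < j → j < k → Disjoint (T i) (T j)
  disjST : ∀ i < k, ∀ j < k, Disjoint (S i) (T j)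

theorem SConn.induce_connected (h : SConn G S) :
    ((⊤ : G.Subgraph).induce S).Connected := by
  obtain ⟨⟨a, ha⟩, h⟩ := h
  rw [SimpleGraph.Subgraph.connected_iff']
  have key : ∀ z ∈ S, ∃ hz : z ∈ S,
      ((⊤ : G.Subgraph).induce S).coe.Reachable ⟨a, ha⟩ ⟨z, hz⟩ := by
    intro z hz
    refine mem_of_reach (G := restr G S) (C := {z | ∃ hz : z ∈ S,
      ((⊤ : G.Subgraph).induce S).coe.Reachable ⟨a, ha⟩ ⟨z, hz⟩}) ?_ (h a ha z hz)
      ⟨ha, .refl _⟩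
    rintro u v ⟨huv, hu, hv⟩ ⟨hu', hr⟩
    refine ⟨hv, hr.trans (SimpleGraph.Adj.reachable ?_)⟩
    simp [hu, hv, huv]
  have : Nonempty ((⊤ : G.Subgraph).induce S).verts := ⟨⟨a, ha⟩⟩
  refine SimpleGraph.Connected.mk ?_
  rintro ⟨u, hu⟩ ⟨v, hv⟩
  obtain ⟨_, h1⟩ := key u hu
  obtain ⟨_, h2⟩ := key v hv
  exact h1.symm.trans h2

theorem ladder_adj {p q : Fin 2 × Fin k} (h : (ladder k).Adj p q) :
    (p.1 ≠ q.1 ∧ p.2 = q.2) ∨ (p.1 = q.1 ∧ (p.2 : ℕ) + 1 = q.2) ∨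
      (p.1 = q.1 ∧ (q.2 : ℕ) + 1 = p.2) := by
  obtain ⟨i, a⟩ := p
  obtain ⟨j, b⟩ := q
  change |((i : ℕ) : ℤ) - ((j : ℕ) : ℤ)| + |((a : ℕ) : ℤ) - ((b : ℕ) : ℤ)| = 1 at h
  have hi := i.2
  have hj := j.2
  simp only [Fin.ext_iff, ne_eq]
  rcases abs_cases (((i : ℕ) : ℤ) - ((j : ℕ) : ℤ)) with h1 | h1 <;>
    rcases abs_cases (((a : ℕ) : ℤ) - ((b : ℕ) : ℤ)) with h2 | h2 <;> omega

theorem LadderSets.isMinor {S T : ℕ → Set V} (h : LadderSets G k S T) :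
    IsMinor (ladder k) G := by
  let σ : Fin 2 × Fin k → Set V := fun p => if p.1 = 0 then S p.2 else T p.2
  refine ⟨fun p => (⊤ : G.Subgraph).induce (σ p), ?_, ?_, ?_⟩
  · rintro ⟨i, a⟩
    apply SConn.induce_connected
    by_cases hi : i = 0
    · simpa [σ, hi] using h.connS a a.2
    · simpa [σ, hi] using h.connT a a.2
  · rintro ⟨i, a⟩ ⟨j, b⟩ hne
    change Disjoint (σ _) (σ _)
    by_cases hi : i = 0 <;> by_cases hj : j = 0 <;> simp only [σ, hi, hj, if_true, if_false]
    · have hab : (a : ℕ) ≠ b := fun h => hne (by rw [hi, hj, Fin.ext h])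
      rcases lt_or_gt_of_ne hab with h' | h'
      · exact h.disjS _ _ h' b.2
      · exact (h.disjS _ _ h' a.2).symm
    · exact h.disjST _ a.2 _ b.2
    · exact (h.disjST _ b.2 _ a.2).symm
    · have hab : (a : ℕ) ≠ b := fun h => hne (by
        have : i = j := by omega
        rw [this, Fin.ext h])
      rcases lt_or_gt_of_ne hab with h' | h'
      · exact h.disjT _ _ h' b.2
      · exact (h.disjT _ _ h' a.2).symm
  · rintro ⟨i, a⟩ ⟨j, b⟩ hadj
    change Touch G (σ _) (σ _)
    rcases ladder_adj hadj with ⟨h1, h2⟩ | ⟨h1, h2⟩ | ⟨h1, h2⟩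
    · simp only at h1 h2
      subst h2
      by_cases hi : i = 0 <;> by_cases hj : j = 0 <;> simp only [σ, hi, hj, if_true, if_false]
      · exact absurd (hi.trans hj.symm) h1
      · exact h.rung _ a.2
      · exact (h.rung _ a.2).symm
      · omega
    · simp only at h1 h2
      subst h1
      have hb := b.2
      by_cases hi : i = 0 <;> simp only [σ, hi, if_true, if_false, ← h2]
      · exact h.railS _ (by omega)
      · exact h.railT _ (by omega)
    · simp only at h1 h2
      subst h1
      have ha := a.2
      by_cases hi : i = 0 <;> simp only [σ, hi, if_true, if_false, ← h2]
      · exact (h.railS _ (by omega)).symm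
      · exact (h.railT _ (by omega)).symm

theorem SConn.exists_touch (hC : SConn G C) (hb : b ∈ C) (hbA : b ∉ A) (hA : (A ∩ C).Nonempty) :
    ∃ y ∈ comp G (C \ A) b, ∃ x ∈ A ∩ C, G.Adj y x := by
  obtain ⟨a, haA, haC⟩ := hA
  have hK : comp G (C \ A) b ⊆ C \ A := comp_subset ⟨hb, hbA⟩
  obtain ⟨u, v, huv, hu, hv, huK, hvK⟩ :=
    hC.exists_crossing hb (mem_comp_self (G := G) (S := C \ A)) haC (fun h => (hK h).2 haA)
  refine ⟨u, huK, v, ⟨?_, hv⟩, huv⟩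
  by_contra hvA
  exact hvK (mem_comp_of_adj huK (hK huK) ⟨hv, hvA⟩ huv)

/-- Inside a connected set meeting `A` and `B`, there is a connected set that avoids `A`, has a
neighbour in `A`, and meets `B` exactly once. -/
theorem SConn.exists_link (hC : SConn G C) (hAB : Disjoint A B) (hA : (A ∩ C).Nonempty)
    (hB : (B ∩ C).Nonempty) : ∃ K ⊆ C, SConn G K ∧ Disjoint K A ∧
      (∃ y ∈ K, ∃ x ∈ A ∩ C, G.Adj y x) ∧ ∃ b, K ∩ B = {b} := by
  obtain ⟨a, haA, haC⟩ := hA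
  obtain ⟨y, hy, b, ⟨hbB, hbC⟩, hyb⟩ :=
    hC.exists_touch haC (fun h => Set.disjoint_left.1 hAB haA h) hB
  have haB : a ∉ B := fun h => Set.disjoint_left.1 hAB haA h
  -- Cut at B first, keeping a single vertex b of B, and only then cut at A around b; the second cut
  -- cannot bring back other vertices of B.
  have hK1 : comp G (C \ B) a ⊆ C \ B := comp_subset ⟨haC, haB⟩
  have hC1 : SConn G (comp G (C \ B) a ∪ {b}) :=
    sconn_comp.union_of_adj sconn_singleton hy rfl hyb
  have hC1C : comp G (C \ B) a ∪ {b} ⊆ C := by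
    rintro z (hz | rfl)
    · exact (hK1 hz).1
    · exact hbC
  have hbA : b ∉ A := fun h => Set.disjoint_left.1 hAB h hbB
  have hb1 : b ∈ comp G (C \ B) a ∪ {b} := Or.inr rfl
  obtain ⟨y', hy', x, ⟨hxA, hxC⟩, hyx⟩ := hC1.exists_touch hb1 hbA ⟨a, haA, Or.inl mem_comp_self⟩
  have hK : comp G ((comp G (C \ B) a ∪ {b}) \ A) b ⊆ (comp G (C \ B) a ∪ {b}) \ A :=
    comp_subset ⟨hb1, hbA⟩
  refine ⟨_, fun z hz => hC1C (hK hz).1, sconn_comp, ?_, ⟨y', hy', x, ⟨hxA, hC1C hxC⟩, hyx⟩, b, ?_⟩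
  · exact Set.disjoint_left.2 fun z hz => (hK hz).2
  · ext z
    constructor
    · rintro ⟨hz, hzB⟩
      rcases (hK hz).1 with h | h
      · exact absurd hzB (hK1 h).2
      · exact h
    · rintro rfl
      exact ⟨mem_comp_self, hbB⟩

/-- The vertices `p a, …, p (b - 1)` of a path `p`. -/
def segment (p : ℕ → V) (a b : ℕ) : Set V := {z | ∃ i, a ≤ i ∧ i < b ∧ p i = z}

theorem sconn_segment {p : ℕ → V} {N a b : ℕ} (hp : ∀ i < N, G.Adj (p i) (p (i + 1)))
    (hab : a < b) (hb : b ≤ N + 1) : SConn G (segment p a b) := by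
  refine sconn_of_forall_reach (a := p a) ⟨a, le_rfl, hab, rfl⟩ ?_
  rintro z ⟨i, hai, hib, rfl⟩
  induction i, hai using Nat.le_induction with
  | base => exact .refl _
  | succ i hi ih =>
    refine (ih (by omega)).trans (reach_of_adj (hp i (by omega)) ?_ ?_)
    · exact ⟨i, hi, by omega, rfl⟩
    · exact ⟨i + 1, by omega, hib, rfl⟩

theorem disjoint_segment {p : ℕ → V} {N a b c d : ℕ} (hp : Set.InjOn p (Set.Iic N))
    (hbc : b ≤ c) (hd : d ≤ N + 1) : Disjoint (segment p a b) (segment p c d) := by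
  rw [Set.disjoint_left]
  rintro z ⟨i, _, hib, rfl⟩ ⟨j, hcj, hjd, h⟩
  have := hp (Set.mem_Iic.2 (by omega)) (Set.mem_Iic.2 (by omega)) h
  omega

theorem touch_segment {p : ℕ → V} {N a b c : ℕ} (hp : ∀ i < N, G.Adj (p i) (p (i + 1)))
    (hab : a < b) (hbc : b < c) (hb : b ≤ N) : Touch G (segment p a b) (segment p b c) := by
  refine ⟨p (b - 1), ⟨b - 1, by omega, by omega, rfl⟩, p b, ⟨b, le_rfl, hbc, rfl⟩, ?_⟩
  have := hp (b - 1) (by omega)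
  rwa [Nat.sub_add_cancel (by omega)] at this

/-- Two disjoint paths with disjoint connections between them that appear in the same order along
both paths form a ladder. -/
theorem ladderSets_of_parallel_paths {p q : ℕ → V} {N M : ℕ}
    (hp : ∀ i < N, G.Adj (p i) (p (i + 1))) (hpi : Set.InjOn p (Set.Iic N))
    (hq : ∀ i < M, G.Adj (q i) (q (i + 1))) (hqi : Set.InjOn q (Set.Iic M))
    (hpq : ∀ i ≤ N, ∀ j ≤ M, p i ≠ q j) {α β : ℕ → ℕ}
    (hα : ∀ s t, s < t → t ≤ k → α s < α t) (hαN : ∀ t ≤ k, α t ≤ N)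
    (hβ : ∀ s t, s < t → t ≤ k → β s < β t) (hβM : ∀ t ≤ k, β t ≤ M)
    {K : ℕ → Set V} (hK : ∀ t ≤ k, SConn G (K t))
    (hKp : ∀ t ≤ k, ∀ i ≤ N, p i ∉ K t) (hKq : ∀ t ≤ k, ∀ i ≤ M, q i ∈ K t ↔ i = β t)
    (hKt : ∀ t ≤ k, Touch G (K t) {p (α t)})
    (hKd : ∀ s t, s < t → t ≤ k → Disjoint (K s) (K t)) :
    LadderSets G k (fun t => segment p (α t) (α (t + 1)))
      (fun t => K t ∪ segment q (β t) (β (t + 1))) := by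
  -- The segments are half-open, each running from one attachment to just before the next, and K t
  -- is absorbed into the rail along q. The last segments end at attachment k, hence k + 1
  -- connections for k rungs.
  have hαle : ∀ s t, s ≤ t → t ≤ k → α s ≤ α t := by
    intro s t hst ht
    rcases hst.lt_or_eq with h | rfl
    · exact (hα s t h ht).le
    · exact le_rfl
  have hβle : ∀ s t, s ≤ t → t ≤ k → β s ≤ β t := by
    intro s t hst ht
    rcases hst.lt_or_eq with h | rfl
    · exact (hβ s t h ht).le
    · exact le_rfl
  have hKseg : ∀ s ≤ k, ∀ t < k, s ≠ t → Disjoint (K s) (segment q (β t) (β (t + 1))) := by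
    intro s hs t ht hne
    rw [Set.disjoint_left]
    rintro z hz ⟨i, h1, h2, rfl⟩
    have h3 := hβM (t + 1) ht
    have h4 := (hKq s hs i (by omega)).1 hz
    subst h4
    rcases lt_or_gt_of_ne hne with h | h
    · exact absurd (hβ s t h ht.le) (by omega)
    · exact absurd (hβle (t + 1) s h hs) (by omega)
  refine ⟨fun t ht => ?_, fun t ht => ?_, fun t ht => ?_, fun t ht => ?_, fun t ht => ?_,
    fun s t hst ht => ?_, fun s t hst ht => ?_, fun s hs t ht => ?_⟩
  · exact sconn_segment hp (hα _ _ (by omega) ht) (by have := hαN (t + 1) ht; omega)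
  · refine (hK t ht.le).union
      (sconn_segment hq (hβ _ _ (by omega) ht) (by have := hβM (t + 1) ht; omega)) ?_
    exact ⟨q (β t), (hKq t ht.le _ (hβM t ht.le)).2 rfl, β t, le_rfl, hβ _ _ (by omega) ht, rfl⟩
  · refine (hKt t ht.le).symm.mono ?_ Set.subset_union_left
    rintro z rfl
    exact ⟨α t, le_rfl, hα _ _ (by omega) ht, rfl⟩
  · exact touch_segment hp (hα _ _ (by omega) ht.le) (hα _ _ (by omega) ht) (hαN _ ht.le)
  · exact (touch_segment hq (hβ _ _ (by omega) ht.le) (hβ _ _ (by omega) ht) (hβM _ ht.le)).mono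
      Set.subset_union_right Set.subset_union_right
  · exact disjoint_segment hpi (hαle _ _ hst ht.le) (by have := hαN (t + 1) ht; omega)
  · rw [Set.disjoint_union_left, Set.disjoint_union_right, Set.disjoint_union_right]
    refine ⟨⟨hKd s t hst ht.le, hKseg s (by omega) t ht hst.ne⟩,
      (hKseg t ht.le s (by omega) hst.ne').symm, ?_⟩
    exact disjoint_segment hqi (hβle _ _ hst ht.le) (by have := hβM (t + 1) ht; omega)
  · rw [Set.disjoint_left]
    rintro z ⟨i, h1, h2, rfl⟩ (hz | ⟨j, h3, h4, h5⟩)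
    · exact hKp t ht.le i (by have := hαN (s + 1) hs; omega) hz
    · exact hpq i (by have := hαN (s + 1) hs; omega) j (by have := hβM (t + 1) ht; omega) h5.symm

/-- Two disjoint paths with more than `k * k` disjoint connections yield a ladder with `k` rungs. -/
theorem isMinor_ladder_of_linked_paths {p q : ℕ → V} {N M : ℕ}
    (hp : ∀ i < N, G.Adj (p i) (p (i + 1))) (hpi : Set.InjOn p (Set.Iic N))
    (hq : ∀ i < M, G.Adj (q i) (q (i + 1))) (hqi : Set.InjOn q (Set.Iic M))
    (hpq : ∀ i ≤ N, ∀ j ≤ M, p i ≠ q j) (hn : k * k < n)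
    (h : Linked G n (segment p 0 (N + 1)) (segment q 0 (M + 1))) : IsMinor (ladder k) G := by
  obtain ⟨C, hC, hA, hB, hd⟩ := h
  have hAB : Disjoint (segment p 0 (N + 1)) (segment q 0 (M + 1)) := by
    rw [Set.disjoint_left]
    rintro z ⟨i, _, hi, rfl⟩ ⟨j, _, hj, h⟩
    exact hpq i (by omega) j (by omega) h.symm
  have hlink := fun i => (hC i).exists_link hAB (hA i) (hB i)
  choose K hKC hK hKA hKt b hb using hlink
  choose y hyK x hx hyx using hKt
  have hα : ∀ i, ∃ a ≤ N, p a = x i := fun i => by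
    obtain ⟨a, _, ha, h⟩ := (hx i).1
    exact ⟨a, by omega, h⟩
  have hβ : ∀ i, ∃ a ≤ M, q a = b i := fun i => by
    have : b i ∈ K i ∩ segment q 0 (M + 1) := by rw [hb i]; rfl
    obtain ⟨a, _, ha, h⟩ := this.2
    exact ⟨a, by omega, h⟩
  choose α hαN hα using hα
  choose β hβM hβ using hβ
  have hbK : ∀ i, b i ∈ K i := fun i => by
    have : b i ∈ K i ∩ segment q 0 (M + 1) := by rw [hb i]; rfl
    exact this.1
  have hαi : Function.Injective α := by
    intro i j hij
    by_contra hne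
    refine Set.disjoint_left.1 (hd i j hne) (hx i).2 ?_
    rw [← hα i, hij, hα j]
    exact (hx j).2
  have hβi : Function.Injective β := by
    intro i j hij
    by_contra hne
    refine Set.disjoint_left.1 (hd i j hne) (hKC i (hbK i)) ?_
    rw [← hβ i, hij, hβ j]
    exact hKC j (hbK j)
  have hKp : ∀ i, ∀ a ≤ N, p a ∉ K i := fun i a ha h =>
    Set.disjoint_left.1 (hKA i) h ⟨a, by omega, by omega, rfl⟩
  have hKq : ∀ i, ∀ a ≤ M, q a ∈ K i ↔ a = β i := by
    intro i a ha
    constructor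
    · intro h
      have : q a ∈ K i ∩ segment q 0 (M + 1) := ⟨h, a, by omega, by omega, rfl⟩
      rw [hb i] at this
      have h' : q a = q (β i) := by rw [hβ i]; exact this
      exact hqi ha (hβM i) h'
    · rintro rfl
      rw [hβ i]
      exact hbK i
  have hKt : ∀ i, Touch G (K i) {p (α i)} := fun i =>
    ⟨y i, hyK i, _, rfl, by rw [hα i]; exact hyx i⟩
  have hKd : ∀ i j, i ≠ j → Disjoint (K i) (K j) := fun i j hij =>
    (hd i j hij).mono (hKC i) (hKC j)
  rcases erdos_szekeres (α := α) (β := β) k k Finset.univ hαi.injOn hβi.injOn (by simpa using hn)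
    with ⟨I, -, hI, hinc⟩ | ⟨I, -, hI, hdec⟩
  · obtain ⟨f, hfI, hf⟩ := exists_enumeration hI hαi.injOn
    refine (ladderSets_of_parallel_paths hp hpi hq hqi hpq (α := α ∘ f) (β := β ∘ f) (K := K ∘ f)
      hf (fun t _ => hαN _) (fun s t hst ht => hinc _ (hfI _) _ (hfI _) (hf s t hst ht))
      (fun t _ => hβM _) (fun t _ => hK _) (fun t _ => hKp _) (fun t _ => hKq _)
      (fun t _ => hKt _) fun s t hst ht => hKd _ _ fun h => ?_).isMinor
    have := hf s t hst ht
    rw [h] at this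
    exact lt_irrefl _ this
  · obtain ⟨f, hfI, hf⟩ := exists_enumeration hI hαi.injOn
    -- Attachments in opposite orders become parallel once q is traversed backwards.
    refine (ladderSets_of_parallel_paths (k := k) (q := fun i => q (M - i)) (N := N) (M := M) hp hpi
      ?_ ?_ ?_
      (α := α ∘ f) (β := fun t => M - β (f t)) (K := K ∘ f)
      hf (fun t _ => hαN _) ?_
      (fun t _ => by omega) (fun t _ => hK _) (fun t _ => hKp _) ?_
      (fun t _ => hKt _) fun s t hst ht => hKd _ _ fun h => ?_).isMinor
    · intro i hi
      have := hq (M - (i + 1)) (by omega)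
      rw [show M - (i + 1) + 1 = M - i by omega] at this
      exact this.symm
    · intro i hi j hj hij
      have := hqi (Set.mem_Iic.2 (by omega)) (Set.mem_Iic.2 (by omega)) hij
      rw [Set.mem_Iic] at hi hj
      omega
    · intro i hi j hj
      exact hpq i hi _ (by omega)
    · intro s t hst ht
      have h1 := hdec _ (hfI s) _ (hfI t) (hf s t hst ht)
      have h2 := hβM (f s)
      omega
    · intro t ht i hi
      have h2 := hβM (f t)
      rw [Function.comp, hKq _ _ (by omega)]
      omega
    · have := hf s t hst ht
      rw [h] at this
      exact lt_irrefl _ this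

end Ladder

/-! ### Rooted ladders in 2-connected sets -/

section RootedLadder

variable {V : Type*} {G : SimpleGraph V} {A B C D S T : Set V} {a b x y : V} {k n : ℕ}

/-- `D` contains a ladder with `j` rungs whose first rung joins a branch set containing `x` to a
branch set containing `y`, and which can be left from both rails at its end. -/
def RootedLadder (G : SimpleGraph V) : ℕ → Set V → V → V → Prop
  | 0, _, _, _ => True
  | j + 1, D, x, y => ∃ S ⊆ D, ∃ T ⊆ D, ∃ E ⊆ D, ∃ x' ∈ E, ∃ y' ∈ E, SConn G S ∧ SConn G T ∧
      x ∈ S ∧ y ∈ T ∧ Disjoint S T ∧ Disjoint S E ∧ Disjoint T E ∧ Touch G S T ∧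
      Touch G S {x'} ∧ Touch G T {y'} ∧ RootedLadder G j E x' y'

theorem RootedLadder.exists_ladderSets : ∀ {j : ℕ} {D : Set V} {x y : V},
    RootedLadder G j D x y → ∃ S T : ℕ → Set V, LadderSets G j S T ∧
      (∀ i < j, S i ⊆ D ∧ T i ⊆ D) ∧ (0 < j → x ∈ S 0 ∧ y ∈ T 0) := by
  intro j
  induction j with
  | zero =>
    intro D x y _
    refine ⟨fun _ => ∅, fun _ => ∅, ?_, fun i hi => absurd hi (Nat.not_lt_zero _),
      fun h => absurd h (lt_irrefl _)⟩
    constructor <;> intros <;> omega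
  | succ j ih =>
    rintro D x y ⟨S, hS, T, hT, E, hE, x', -, y', -, hSc, hTc, hx, hy, hST, hSE, hTE, hr,
      hSx, hTy, h⟩
    obtain ⟨S', T', hL, hsub, hroot⟩ := ih h
    refine ⟨fun i => Nat.casesOn i S S', fun i => Nat.casesOn i T T', ?_, ?_, fun _ => ⟨hx, hy⟩⟩
    · refine ⟨?_, ?_, ?_, ?_, ?_, ?_, ?_, ?_⟩
      · rintro (_ | i) hi
        · exact hSc
        · exact hL.connS i (by omega)
      · rintro (_ | i) hi
        · exact hTc
        · exact hL.connT i (by omega)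
      · rintro (_ | i) hi
        · exact hr
        · exact hL.rung i (by omega)
      · rintro (_ | i) hi
        · exact hSx.mono le_rfl (Set.singleton_subset_iff.2 (hroot (by omega)).1)
        · exact hL.railS i (by omega)
      · rintro (_ | i) hi
        · exact hTy.mono le_rfl (Set.singleton_subset_iff.2 (hroot (by omega)).2)
        · exact hL.railT i (by omega)
      · rintro (_ | s) (_ | t) hst ht
        · omega
        · exact hSE.mono_right (hsub t (by omega)).1
        · omega
        · exact hL.disjS s t (by omega) (by omega)
      · rintro (_ | s) (_ | t) hst ht
        · omega
        · exact hTE.mono_right (hsub t (by omega)).2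
        · omega
        · exact hL.disjT s t (by omega) (by omega)
      · rintro (_ | s) hs (_ | t) ht
        · exact hST
        · exact hSE.mono_right (hsub t (by omega)).2
        · exact (hTE.mono_right (hsub s (by omega)).1).symm
        · exact hL.disjST s (by omega) t (by omega)
    · rintro (_ | i) hi
      · exact ⟨hS, hT⟩
      · exact ⟨(hsub i (by omega)).1.trans hE, (hsub i (by omega)).2.trans hE⟩

theorem RootedLadder.isMinor (h : RootedLadder G k D x y) : IsMinor (ladder k) G := by
  obtain ⟨S, T, hL, -⟩ := h.exists_ladderSets
  exact hL.isMinor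

/-- The subgraph induced by `D` cannot be disconnected by deleting fewer than two vertices. -/
def TwoConn (G : SimpleGraph V) (D : Set V) : Prop :=
  ∀ X : Finset V, X.card < 2 → ∀ a ∈ D, ∀ b ∈ D, a ∉ X → b ∉ X →
    (restr G {z | z ∈ D ∧ z ∉ X}).Reachable a b

theorem TwoConn.sconn (h : TwoConn G D) (hD : D.Nonempty) : SConn G D :=
  ⟨hD, fun a ha b hb => reach_mono (fun _ hz => hz.1)
    (h ∅ (by simp) a ha b hb (by simp) (by simp))⟩

theorem restr_le : restr G S ≤ G := fun _ _ h => h.1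

theorem restr_restr_le : restr (restr G D) S ≤ restr G D := fun _ _ h => h.1

theorem SConn.subset_of_restr (h : SConn (restr G D) S) (ha : a ∈ S) (haD : a ∈ D) : S ⊆ D :=
  fun z hz => mem_of_reach_restr ((h.2 a ha z hz).mono restr_restr_le) haD

/-- Two vertices of a 2-connected set `D` can be linked disjointly to any two-element subset; if
they are also connected outside that subset, a ladder rooted in the subset gains a rung. -/
theorem TwoConn.exists_gain [Finite V] (hD : TwoConn G D) (hx : x ∈ D) (hy : y ∈ D) (hxy : x ≠ y)
    (hBD : B ⊆ D) (hB : B.Nontrivial) {H : Set V} (hHD : H ⊆ D) (hH : SConn G H) (hxH : x ∈ H)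
    (hyH : y ∈ H) (hHB : Disjoint H B) :
    ∃ x' ∈ B, ∃ y' ∈ B, x' ≠ y' ∧
      ∀ j, RootedLadder G j B x' y' → RootedLadder G (j + 1) D x y := by
  classical
  -- A single vertex cannot cover {x, y} or B, and 2-connectivity of D joins what it leaves.
  have hlink : Linked (restr G D) 2 {x, y} B := by
    apply menger
    intro X hX
    obtain ⟨a, ha, haX⟩ : ∃ a ∈ ({x, y} : Set V), a ∉ X := by
      by_contra! h
      have : ({x, y} : Finset V) ⊆ X := by
        intro z hz
        exact h z (by simpa using hz)
      have := Finset.card_le_card this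
      rw [Finset.card_pair hxy] at this
      omega
    obtain ⟨b, hb, hbX⟩ : ∃ b ∈ B, b ∉ X := by
      by_contra! h
      obtain ⟨p, hp, q, hq, hpq⟩ := hB
      have : ({p, q} : Finset V) ⊆ X := by
        intro z hz
        rcases Finset.mem_insert.1 hz with rfl | hz
        · exact h _ hp
        · rw [Finset.mem_singleton.1 hz]; exact h _ hq
      have := Finset.card_le_card this
      rw [Finset.card_pair hpq] at this
      omega
    have haD : a ∈ D := by rcases ha with rfl | rfl <;> assumption
    refine ⟨a, ha, b, hb, haX, hbX, (hD X hX a haD b (hBD hb) haX hbX).mono ?_⟩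
    rintro u v ⟨huv, hu, hv⟩
    exact ⟨⟨huv, hu.1, hv.1⟩, hu.2, hv.2⟩
  obtain ⟨C, hC, hCx, hCB, hd⟩ := hlink
  obtain ⟨C₁, C₂, h1, h2, hx1, hy2, hB1, hB2, hd⟩ : ∃ C₁ C₂ : Set V, SConn (restr G D) C₁ ∧
      SConn (restr G D) C₂ ∧ x ∈ C₁ ∧ y ∈ C₂ ∧ (B ∩ C₁).Nonempty ∧ (B ∩ C₂).Nonempty ∧
      Disjoint C₁ C₂ := by
    obtain ⟨c, hc, hc0⟩ := hCx 0
    obtain ⟨d, hd', hd1⟩ := hCx 1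
    have h01 := hd 0 1 (by decide)
    rcases hc with rfl | hc <;> rcases hd' with rfl | hd'
    · exact absurd hd1 (Set.disjoint_left.1 h01 hc0)
    · rw [Set.mem_singleton_iff] at hd'
      subst hd'
      exact ⟨C 0, C 1, hC 0, hC 1, hc0, hd1, hCB 0, hCB 1, h01⟩
    · rw [Set.mem_singleton_iff] at hc
      subst hc
      exact ⟨C 1, C 0, hC 1, hC 0, hd1, hc0, hCB 1, hCB 0, h01.symm⟩
    · rw [Set.mem_singleton_iff] at hc hd'
      subst hc
      subst hd'
      exact absurd hd1 (Set.disjoint_left.1 h01 hc0)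
  have hC1D := h1.subset_of_restr hx1 hx
  have hC2D := h2.subset_of_restr hy2 hy
  have hle : restr G D ≤ G := restr_le
  have hxB : x ∉ B := Set.disjoint_left.1 hHB hxH
  have hyB : y ∉ B := Set.disjoint_left.1 hHB hyH
  obtain ⟨p, hp, x', ⟨hx'B, hx'C⟩, hpx⟩ := (h1.mono hle).exists_touch hx1 hxB hB1
  obtain ⟨q, hq, y', ⟨hy'B, hy'C⟩, hqy⟩ := (h2.mono hle).exists_touch hy2 hyB hB2
  set S := comp G (C₁ \ B) x
  set T₀ := comp G (C₂ \ B) y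
  have hS : S ⊆ C₁ \ B := comp_subset ⟨hx1, hxB⟩
  have hT₀ : T₀ ⊆ C₂ \ B := comp_subset ⟨hy2, hyB⟩
  have hSc : SConn G S := sconn_comp
  have hT₀c : SConn G T₀ := sconn_comp
  have hxS : x ∈ S := mem_comp_self
  have hyT₀ : y ∈ T₀ := mem_comp_self
  have hST₀ : Disjoint S T₀ := hd.mono (fun z hz => (hS hz).1) (fun z hz => (hT₀ hz).1)
  have hyS : y ∉ S := fun h => Set.disjoint_left.1 hST₀ h hyT₀
  -- S and T₀ are the links cut off before B. To make a rung, T₀ grows along H until it touches S: T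
  -- is the component of y in the union with S removed. It avoids B because H does.
  have hU : SConn G ((S ∪ H) ∪ T₀) := (hSc.union hH ⟨x, hxS, hxH⟩).union hT₀c
    ⟨y, Or.inr hyH, hyT₀⟩
  have hyU : y ∈ (S ∪ H) ∪ T₀ := Or.inr hyT₀
  obtain ⟨t, ht, s, ⟨hs, -⟩, hts⟩ := hU.exists_touch hyU hyS ⟨x, hxS, Or.inl (Or.inl hxS)⟩
  set T := comp G (((S ∪ H) ∪ T₀) \ S) y
  have hT : T ⊆ ((S ∪ H) ∪ T₀) \ S := comp_subset ⟨hyU, hyS⟩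
  have hT₀T : T₀ ⊆ T := hT₀c.subset_comp
    (fun z hz => ⟨Or.inr hz, Set.disjoint_right.1 hST₀ hz⟩) hyT₀
  refine ⟨x', hx'B, y', hy'B, ?_, fun j hj => ⟨S, fun z hz => hC1D (hS hz).1, T, ?_, B, hBD, x',
    hx'B, y', hy'B, hSc, sconn_comp, hxS, mem_comp_self, ?_, ?_, ?_, ⟨s, hs, t, ht, hts.symm⟩,
    ⟨p, hp, x', rfl, hpx⟩, ⟨q, hT₀T hq, y', rfl, hqy⟩, hj⟩⟩
  · rintro rfl
    exact Set.disjoint_left.1 hd hx'C hy'C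
  · intro z hz
    rcases (hT hz).1 with (h | h) | h
    · exact hC1D (hS h).1
    · exact hHD h
    · exact hC2D (hT₀ h).1
  · exact Set.disjoint_right.2 fun z hz => (hT hz).2
  · exact Set.disjoint_left.2 fun z hz => (hS hz).2
  · refine Set.disjoint_left.2 fun z hz => ?_
    rcases (hT hz).1 with (h | h) | h
    · exact (hS h).2
    · exact Set.disjoint_left.1 hHB h
    · exact (hT₀ h).2

theorem SConn.exists_path (hC : SConn G C) (ha : a ∈ C) (hb : b ∈ C) :
    ∃ (p : ℕ → V) (N : ℕ), p 0 = a ∧ p N = b ∧ (∀ i < N, G.Adj (p i) (p (i + 1))) ∧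
      Set.InjOn p (Set.Iic N) ∧ ∀ i, p i ∈ C := by
  classical
  obtain ⟨w⟩ := hC.2 a ha b hb
  let q := w.toPath
  refine ⟨(q : (restr G C).Walk a b).getVert, (q : (restr G C).Walk a b).length,
    SimpleGraph.Walk.getVert_zero _, SimpleGraph.Walk.getVert_length _, fun i hi => ?_, ?_,
    fun i => ?_⟩
  · exact (SimpleGraph.Walk.adj_getVert_succ _ hi).1
  · exact q.2.getVert_injOn
  · refine mem_of_reach_restr (G := G) (a := a) ?_ ha
    exact ⟨(q : (restr G C).Walk a b).take i⟩

/-- Two nonadjacent vertices of a 2-connected set are joined by two disjoint paths. -/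
theorem TwoConn.linked_neighbors [Finite V] (hD : TwoConn G D) (hx : x ∈ D) (hy : y ∈ D)
    (hxy : x ≠ y) (hadj : ¬ G.Adj x y) :
    Linked (restr G (D \ {x, y})) 2 {z | z ∈ D \ {x, y} ∧ G.Adj x z}
      {z | z ∈ D \ {x, y} ∧ G.Adj z y} := by
  classical
  apply menger
  intro X hX
  by_contra! hno
  -- A separator may contain x or y, but the linked sets live in D without them, so both can be
  -- dropped before 2-connectivity is applied to x and y.
  let X' := (X.erase x).erase y
  have hX' : X'.card < 2 :=
    (Finset.card_le_card ((Finset.erase_subset _ _).trans (Finset.erase_subset _ _))).trans_lt hX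
  have hr := hD X' hX' x hx y hy (by simp [X']) (by simp [X'])
  let R : Set V := {z | z ∈ D \ {x, y} ∧ z ∉ X ∧ ∃ a, (a ∈ D \ {x, y} ∧ G.Adj x a) ∧ a ∉ X ∧
    z ∈ comp (restr G (D \ {x, y})) {z | z ∉ X} a}
  have : y ∈ insert x R := by
    refine mem_of_reach (G := restr G {z | z ∈ D ∧ z ∉ X'}) ?_ hr (Set.mem_insert _ _)
    rintro u v ⟨huv, -, hv⟩ hu
    by_cases hvx : v = x
    · exact Or.inl hvx
    by_cases hvy : v = y
    · subst hvy
      rcases hu with rfl | ⟨huD, huX, a, ha, haX, hua⟩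
      · exact absurd huv hadj
      · exact absurd hua (hno a ha u ⟨huD, huv⟩ haX huX)
    have hvX : v ∉ X := fun h => hv.2 (by simp [X', hvx, hvy, h])
    have hvD : v ∈ D \ {x, y} := ⟨hv.1, by simp [hvx, hvy]⟩
    right
    rcases hu with rfl | ⟨huD, huX, a, ha, haX, hua⟩
    · exact ⟨hvD, hvX, v, ⟨hvD, huv⟩, hvX, mem_comp_self⟩
    · exact ⟨hvD, hvX, a, ha, haX, mem_comp_of_adj hua huX hvX ⟨huv, huD, hvD⟩⟩
  rcases this with h | h
  · exact hxy h.symm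
  · exact h.1.2 (by simp)

/-- In a graph without a ladder minor, a bounded set of vertices of a 2-connected set `D` suffices
to have every connected subset of `D` that it misses avoided by a path between given vertices. -/
theorem TwoConn.exists_avoiding [Finite V] (hk : ¬ IsMinor (ladder k) G) (hD : TwoConn G D)
    (hx : x ∈ D) (hy : y ∈ D) (hxy : x ≠ y) :
    ∃ W : Finset V, W.card ≤ k * k + 2 ∧ ∀ B ⊆ D, SConn G B → (∀ z ∈ B, z ∉ W) →
      ∃ H ⊆ D, SConn G H ∧ x ∈ H ∧ y ∈ H ∧ Disjoint H B := by
  classical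
  by_cases hadj : G.Adj x y
  · refine ⟨{x, y}, (Finset.card_le_two).trans (by omega), fun B _ _ hBW =>
      ⟨{x, y}, ?_, sconn_pair hadj, by simp, by simp, ?_⟩⟩
    · rintro z (rfl | rfl) <;> assumption
    · exact Set.disjoint_right.2 fun z hz h => hBW z hz (by simpa using h)
  obtain ⟨C, hC, hCx, hCy, hd⟩ := hD.linked_neighbors hx hy hxy hadj
  have hpath : ∀ i, ∃ (p : ℕ → V) (N : ℕ), G.Adj x (p 0) ∧ G.Adj (p N) y ∧
      (∀ i < N, G.Adj (p i) (p (i + 1))) ∧ Set.InjOn p (Set.Iic N) ∧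
      (∀ j, p j ∈ C i) ∧ ∀ j, p j ∈ D \ {x, y} := by
    intro i
    obtain ⟨a, ⟨haD, hxa⟩, haC⟩ := hCx i
    obtain ⟨b, ⟨hbD, hby⟩, hbC⟩ := hCy i
    obtain ⟨p, N, rfl, rfl, hp, hpi, hpC⟩ := ((hC i).mono restr_le).exists_path haC hbC
    exact ⟨p, N, hxa, hby, hp, hpi, hpC, fun j => (hC i).subset_of_restr haC haD (hpC j)⟩
  obtain ⟨p, N, hxp, hpy, hp, hpi, hpC, hpD⟩ := hpath 0
  obtain ⟨q, M, hxq, hqy, hq, hqi, hqC, hqD⟩ := hpath 1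
  have hpq : ∀ i ≤ N, ∀ j ≤ M, p i ≠ q j := fun i _ j _ h =>
    Set.disjoint_left.1 (hd 0 1 (by decide)) (hpC i) (h ▸ hqC j)
  -- By Menger, the lack of a ladder gives at most k² separating vertices; adding x and y gives W.
  have hsep : ¬ Unseparated (restr G (D \ {x, y})) (k * k + 1) (segment p 0 (N + 1))
      (segment q 0 (M + 1)) := by
    intro hun
    obtain ⟨K, hK, h1, h2, h3⟩ := menger _ _ _ hun
    exact hk (isMinor_ladder_of_linked_paths hp hpi hq hqi hpq (Nat.lt_succ_self _)
      ⟨K, fun i => (hK i).mono restr_le, h1, h2, h3⟩)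
  unfold Unseparated at hsep
  push Not at hsep
  obtain ⟨X, hX, hsep⟩ := hsep
  have hext : ∀ (p : ℕ → V) (N : ℕ), G.Adj x (p 0) → G.Adj (p N) y →
      (∀ i < N, G.Adj (p i) (p (i + 1))) → (∀ j, p j ∈ D \ {x, y}) → ∀ B : Set V,
      x ∉ B → y ∉ B → Disjoint (segment p 0 (N + 1)) B →
      ∃ H ⊆ D, SConn G H ∧ x ∈ H ∧ y ∈ H ∧ Disjoint H B := by
    intro p N hxp hpy hp hpD B hxB hyB hpB
    refine ⟨{x} ∪ segment p 0 (N + 1) ∪ {y}, ?_, ?_, by simp, by simp, ?_⟩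
    · rintro z ((rfl | ⟨i, -, -, rfl⟩) | rfl)
      · exact hx
      · exact (hpD i).1
      · exact hy
    · refine (sconn_singleton.union_of_adj (sconn_segment hp (by omega) le_rfl) rfl
        ⟨0, le_rfl, by omega, rfl⟩ hxp).union_of_adj sconn_singleton (Or.inr ?_) rfl hpy
      exact ⟨N, by omega, by omega, rfl⟩
    · simp [hxB, hyB, hpB]
  refine ⟨insert x (insert y X), ?_, fun B hBD hB hBW => ?_⟩
  · have h1 := Finset.card_insert_le x (insert y X)
    have h2 := Finset.card_insert_le y X
    omega
  have hxB : x ∉ B := fun h => hBW x h (by simp)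
  have hyB : y ∉ B := fun h => hBW y h (by simp)
  have hBX : ∀ z ∈ B, z ∉ X := fun z hz h => hBW z hz (by simp [h])
  by_cases hpB : Disjoint (segment p 0 (N + 1)) B
  · exact hext p N hxp hpy hp hpD B hxB hyB hpB
  by_cases hqB : Disjoint (segment q 0 (M + 1)) B
  · exact hext q M hxq hqy hq hqD B hxB hyB hqB
  obtain ⟨a, ha, haB⟩ := Set.not_disjoint_iff.1 hpB
  obtain ⟨b, hb, hbB⟩ := Set.not_disjoint_iff.1 hqB
  -- A connected B missing W but meeting both paths would join them around the separator.
  refine absurd ((hB.2 a haB b hbB).mono ?_) (hsep a ha b hb (hBX a haB) (hBX b hbB))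
  rintro u v ⟨huv, hu, hv⟩
  have hBD' : ∀ z ∈ B, z ∈ D \ {x, y} := by
    rintro z hz
    refine ⟨hBD hz, ?_⟩
    rintro (rfl | rfl) <;> contradiction
  exact ⟨⟨huv, hBD' u hu, hBD' v hv⟩, hBX u hu, hBX v hv⟩

end RootedLadder

/-! ### Retractions onto blocks -/

section Retraction

variable {V : Type*} {G : SimpleGraph V} {B C D S T : Set V} {a b r x y : V} {u : V → V}

/-- `u` retracts `S` onto a subset `B` so that every edge inside `S` is either contracted or lies
in `B`: the part of `S` outside `B` hangs on `B` at cut vertices. -/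
structure IsRetraction (G : SimpleGraph V) (S : Set V) (u : V → V) : Prop where
  maps : ∀ x ∈ S, u x ∈ S
  idem : ∀ x ∈ S, u (u x) = u x
  adj : ∀ x ∈ S, ∀ y ∈ S, G.Adj x y → u x = u y ∨ (u x = x ∧ u y = y)

/-- The set of fixed points of `u` in `S`. -/
def core (S : Set V) (u : V → V) : Set V := {z | z ∈ S ∧ u z = z}

theorem IsRetraction.mem_core (hu : IsRetraction G S u) (hx : x ∈ S) : u x ∈ core S u :=
  ⟨hu.maps x hx, hu.idem x hx⟩

theorem IsRetraction.comp {f : V → V} (hu : IsRetraction G S u)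
    (hf : IsRetraction G (core S u) f) :
    IsRetraction G S (f ∘ u) ∧ core S (f ∘ u) = core (core S u) f := by
  refine ⟨⟨fun x hx => (hf.maps _ (hu.mem_core hx)).1, fun x hx => ?_, fun x hx y hy h => ?_⟩, ?_⟩
  · have h1 := hf.maps _ (hu.mem_core hx)
    simp only [Function.comp]
    rw [h1.2, hf.idem _ (hu.mem_core hx)]
  · rcases hu.adj x hx y hy h with h1 | ⟨h1, h2⟩
    · left; simp only [Function.comp, h1]
    · simp only [Function.comp, h1, h2]
      exact hf.adj x ⟨hx, h1⟩ y ⟨hy, h2⟩ h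
  · ext z
    constructor
    · rintro ⟨hz, hfz⟩
      have h1 := hf.maps _ (hu.mem_core hz)
      have h2 : u z = z := by
        have := h1.2
        rwa [show f (u z) = z from hfz] at this
      exact ⟨⟨hz, h2⟩, by rw [← h2]; simpa [h2] using hfz⟩
    · rintro ⟨⟨hz, h1⟩, h2⟩
      exact ⟨hz, by simp [h1, h2]⟩

/-- A set that is not 2-connected and has more than two elements retracts onto a smaller one. -/
theorem exists_smaller_retraction [Finite V] (hr : r ∈ B) (h2 : 2 < B.ncard)
    (hB : ¬ TwoConn G B) : ∃ f, IsRetraction G B f ∧ f r = r ∧ (core B f).Nontrivial ∧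
      (core B f).ncard < B.ncard := by
  classical
  have hlt : ∀ f : V → V, (∃ z ∈ B, f z ≠ z) → (core B f).ncard < B.ncard := by
    rintro f ⟨z, hz, hfz⟩
    exact Set.ncard_lt_ncard ⟨fun w hw => hw.1, fun h => hfz (h hz).2⟩ (Set.toFinite _)
  unfold TwoConn at hB
  push Not at hB
  obtain ⟨X, hX, a, ha, b, hb, haX, hbX, hab⟩ := hB
  by_cases hXB : ∃ c ∈ X, c ∈ B
  · obtain ⟨c, hcX, hcB⟩ := hXB
    obtain rfl : X = {c} := by
      apply (Finset.eq_of_subset_of_card_le (Finset.singleton_subset_iff.2 hcX) _).symm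
      rw [Finset.card_singleton]; omega
    set R : Set V := {z | z ∈ B ∧ z ∉ ({c} : Finset V)} with hR
    have haR : a ∈ R := ⟨ha, haX⟩
    have hbR : b ∈ R := ⟨hb, hbX⟩
    -- The component to be collapsed onto the cut vertex c must miss the root r. The element e also
    -- survives, so that the core keeps two elements.
    obtain ⟨d, hdR, hrd, e, heB, hec, hed⟩ : ∃ d ∈ R, r ∉ PosetLadder.comp G R d ∧
        ∃ e ∈ B, e ≠ c ∧ e ∉ PosetLadder.comp G R d := by
      by_cases hrc : r = c
      · refine ⟨b, hbR, fun h => ?_, a, ha, by simpa using haX, fun h => hab h.symm⟩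
        have := comp_subset hbR h
        simp [hR, hrc] at this
      · by_cases hrb : r ∈ PosetLadder.comp G R b
        · have hra : r ∉ PosetLadder.comp G R a := fun h =>
            hab (SimpleGraph.Reachable.trans h hrb.symm)
          exact ⟨a, haR, hra, r, hr, hrc, hra⟩
        · exact ⟨b, hbR, hrb, r, hr, hrc, hrb⟩
    have hcR : c ∉ PosetLadder.comp G R d := fun h => by
      have := comp_subset hdR h
      simp [hR] at this
    let f : V → V := fun z => if z ∈ PosetLadder.comp G R d then c else z
    have hfc : f c = c := if_neg hcR
    refine ⟨f, ⟨fun x hx => ?_, fun x hx => ?_, fun x hx y hy h => ?_⟩, if_neg hrd,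
      ⟨c, ⟨hcB, hfc⟩, e, ⟨heB, if_neg hed⟩, hec.symm⟩, hlt f ⟨d, hdR.1, ?_⟩⟩
    · by_cases h : x ∈ PosetLadder.comp G R d <;> simp [f, h, hcB, hx]
    · by_cases h : x ∈ PosetLadder.comp G R d <;> simp [f, h]
    · by_cases h1 : x ∈ PosetLadder.comp G R d <;> by_cases h2 : y ∈ PosetLadder.comp G R d
      · simp [f, h1, h2]
      · have : y = c := by
          by_contra hyc
          exact h2 (mem_comp_of_adj h1 (comp_subset hdR h1) ⟨hy, by simpa using hyc⟩ h)
        subst this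
        simp [f, h1]
      · have : x = c := by
          by_contra hxc
          exact h1 (mem_comp_of_adj h2 (comp_subset hdR h2) ⟨hx, by simpa using hxc⟩ h.symm)
        subst this
        simp [f, h2]
      · simp [f, h1, h2]
    · have hd : f d = c := if_pos mem_comp_self
      rw [hd]
      rintro rfl
      exact hcR mem_comp_self
  · have hset : {z | z ∈ B ∧ z ∉ X} = B := by
      ext z
      exact ⟨fun h => h.1, fun h => ⟨h, fun hX => hXB ⟨z, hX, h⟩⟩⟩
    rw [hset] at hab
    obtain ⟨d, hdB, hrd⟩ : ∃ d ∈ B, d ∉ PosetLadder.comp G B r := by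
      by_contra! h
      exact hab ((SimpleGraph.Reachable.symm (h a ha)).trans (h b hb))
    -- B is disconnected here: collapse the component of r to r and everything else to d. Every edge
    -- is contracted.
    let f : V → V := fun z => if z ∈ PosetLadder.comp G B r then r else d
    have hfr : f r = r := if_pos mem_comp_self
    have hfd : f d = d := if_neg hrd
    have hf : ∀ z, f z = r ∨ f z = d := fun z => by
      by_cases h : z ∈ PosetLadder.comp G B r <;> simp [f, h]
    refine ⟨f, ⟨fun x _ => ?_, fun x _ => ?_, fun x hx y hy h => ?_⟩, hfr,
      ⟨r, ⟨hr, hfr⟩, d, ⟨hdB, hfd⟩, ?_⟩, hlt f ?_⟩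
    · rcases hf x with h | h <;> rw [h] <;> assumption
    · rcases hf x with h | h <;> rw [h] <;> assumption
    · left
      have : x ∈ PosetLadder.comp G B r ↔ y ∈ PosetLadder.comp G B r :=
        ⟨fun h1 => mem_comp_of_adj h1 hx hy h, fun h1 => mem_comp_of_adj h1 hy hx h.symm⟩
      simp [f, this]
    · rintro rfl
      exact hrd mem_comp_self
    · by_contra! h
      have hsub : B ⊆ {r, d} := by
        intro z hz
        rw [← h z hz]
        rcases hf z with h' | h' <;> rw [h'] <;> simp
      have h3 := Set.ncard_le_ncard hsub (Set.toFinite _)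
      have h4 := Set.ncard_insert_le r {d}
      rw [Set.ncard_singleton] at h4
      omega

/-- Every set with at least two elements retracts onto a block or a pair containing a given
element. -/
theorem exists_block_retraction [Finite V] (hr : r ∈ S) (hS : S.Nontrivial) :
    ∃ u, IsRetraction G S u ∧ u r = r ∧ (core S u).Nontrivial ∧
      ((core S u).ncard ≤ 2 ∨ TwoConn G (core S u)) := by
  suffices ∀ (m : ℕ) (u : V → V), (core S u).ncard = m → IsRetraction G S u → u r = r →
      (core S u).Nontrivial → ∃ u, IsRetraction G S u ∧ u r = r ∧ (core S u).Nontrivial ∧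
      ((core S u).ncard ≤ 2 ∨ TwoConn G (core S u)) by
    refine this _ id rfl ⟨fun x hx => hx, fun x _ => rfl, fun x _ y _ _ => Or.inr ⟨rfl, rfl⟩⟩ rfl ?_
    have : core S id = S := by ext z; simp [core]
    rwa [this]
  intro m
  induction m using Nat.strong_induction_on with
  | _ m ih =>
  rintro u rfl hu hur hnt
  by_cases h2 : (core S u).ncard ≤ 2
  · exact ⟨u, hu, hur, hnt, Or.inl h2⟩
  by_cases hT : TwoConn G (core S u)
  · exact ⟨u, hu, hur, hnt, Or.inr hT⟩
  obtain ⟨f, hf, hfr, hfnt, hflt⟩ := exists_smaller_retraction (B := core S u) ⟨hr, hur⟩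
    (not_le.1 h2) hT
  obtain ⟨h1, h3⟩ := hu.comp hf
  exact ih _ (h3 ▸ hflt) (f ∘ u) rfl h1 (by simp [hur, hfr]) (h3 ▸ hfnt)

end Retraction

/-! ### Linear extensions as integer keys; deleting elements -/

section Keys

variable {P : Type*} [PartialOrder P] {S T : Set P} {u : P → P} {r w : P} {n m : ℕ}

/-- `f` induces a linear extension of the subposet on `S`. -/
structure IsKey (S : Set P) (f : P → ℤ) : Prop where
  inj : Set.InjOn f S
  mono : ∀ x ∈ S, ∀ y ∈ S, x ≤ y → f x ≤ f y

theorem IsKey.lt {f : P → ℤ} (hf : IsKey S f) {x y : P} (hx : x ∈ S) (hy : y ∈ S) (hxy : x ≤ y)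
    (hne : x ≠ y) : f x < f y :=
  lt_of_le_of_ne (hf.mono x hx y hy hxy) fun h => hne (hf.inj hx hy h)

theorem IsKey.subset {f : P → ℤ} (hf : IsKey S f) (h : T ⊆ S) : IsKey T f :=
  ⟨hf.inj.mono h, fun x hx y hy => hf.mono x (h hx) y (h hy)⟩

/-- The subposet on `S` has dimension at most `n`: it has a realizer of `n` linear extensions. -/
def Emb (n : ℕ) (S : Set P) : Prop :=
  ∃ f : Fin n → P → ℤ, (∀ i, IsKey S (f i)) ∧
    ∀ x ∈ S, ∀ y ∈ S, ¬ x ≤ y → ∃ i, f i y < f i x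

/-- A strictly monotone function into a linear order can be replaced by a key. -/
theorem exists_key_of_lt [Finite P] {α : Type*} [LinearOrder α] (f : P → α)
    (hf : ∀ x ∈ S, ∀ y ∈ S, x ≠ y → f x ≠ f y) (hm : ∀ x ∈ S, ∀ y ∈ S, x < y → f x < f y) :
    ∃ g, IsKey S g ∧ ∀ x ∈ S, ∀ y ∈ S, f x < f y → g x < g y := by
  have key : ∀ x ∈ S, ∀ y ∈ S, f x < f y →
      (({z | z ∈ S ∧ f z < f x}.ncard : ℕ) : ℤ) < ({z | z ∈ S ∧ f z < f y}.ncard : ℕ) := by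
    intro x hx y _ hxy
    have : {z | z ∈ S ∧ f z < f x}.ncard < {z | z ∈ S ∧ f z < f y}.ncard := by
      refine Set.ncard_lt_ncard ⟨fun z hz => ⟨hz.1, hz.2.trans hxy⟩, fun h => ?_⟩ (Set.toFinite _)
      exact lt_irrefl _ (h ⟨hx, hxy⟩).2
    exact_mod_cast this
  -- The key is the rank of x in S under f.
  refine ⟨fun x => ({z | z ∈ S ∧ f z < f x}.ncard : ℕ), ⟨fun x hx y hy hxy => ?_,
    fun x hx y hy hxy => ?_⟩, key⟩
  · by_contra hne
    rcases lt_or_gt_of_ne (hf x hx y hy hne) with h | h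
    · exact (key x hx y hy h).ne hxy
    · exact (key y hy x hx h).ne' hxy
  · rcases hxy.eq_or_lt with rfl | h
    · exact le_rfl
    · exact (key x hx y hy (hm x hx y hy h)).le

variable (P) in
theorem exists_key [Finite P] : ∃ f : P → ℤ, IsKey Set.univ f := by
  obtain ⟨g, hg, -⟩ := exists_key_of_lt (S := (Set.univ : Set P))
    (fun x => toLinearExtension x) (fun x _ y _ hne h => hne h)
    (fun x _ y _ hxy => lt_of_le_of_ne (toLinearExtension.monotone hxy.le) fun h => hxy.ne h)
  exact ⟨g, hg⟩

theorem emb_of_fintype [Finite P] {ι : Type*} [Fintype ι] (hι : Fintype.card ι ≤ n)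
    (f : ι → P → ℤ) (hf : ∀ i, IsKey S (f i))
    (h : ∀ x ∈ S, ∀ y ∈ S, ¬ x ≤ y → ∃ i, f i y < f i x) : Emb n S := by
  obtain ⟨L, hL⟩ := exists_key P
  let e := Fintype.equivFin ι
  refine ⟨fun i => if h : (i : ℕ) < Fintype.card ι then f (e.symm ⟨i, h⟩) else L, fun i => ?_,
    fun x hx y hy hxy => ?_⟩
  · by_cases hi : (i : ℕ) < Fintype.card ι
    · simp only [hi, dif_pos]
      exact hf _
    · simp only [hi, dif_neg, not_false_eq_true]
      exact hL.subset (Set.subset_univ _)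
  · obtain ⟨i, hi⟩ := h x hx y hy hxy
    refine ⟨⟨e i, (e i).2.trans_le hι⟩, ?_⟩
    simpa using hi

theorem Emb.mono [Finite P] (h : Emb n S) (hnm : n ≤ m) : Emb m S := by
  obtain ⟨f, hf, h⟩ := h
  exact emb_of_fintype (by simpa using hnm) f hf h

theorem emb_of_subsingleton [Finite P] (hS : S.Subsingleton) : Emb n S :=
  emb_of_fintype (ι := Empty) (by simp) Empty.elim (fun i => i.elim)
    fun x hx y hy hxy => absurd (hS hx hy).le hxy

theorem emb_pair [Finite P] (a b : P) (hn : 2 ≤ n) : Emb n ({a, b} : Set P) := by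
  obtain ⟨L, hL⟩ := exists_key P
  have hL' := hL.subset (Set.subset_univ ({a, b} : Set P))
  by_cases hab : a ≤ b ∨ b ≤ a
  · refine emb_of_fintype (ι := Unit) (by simp; omega) (fun _ => L) (fun _ => hL') ?_
    intro x hx y hy hxy
    have : y ≤ x := by
      rcases hx with rfl | rfl <;> rcases hy with rfl | rfl <;> tauto
    exact ⟨(), hL'.lt hy hx this fun h => hxy h.ge⟩
  · push Not at hab
    refine emb_of_fintype (ι := Bool) (by simpa using hn) (fun c => if c then L else fun x => - L x)
      ?_ ?_
    · rintro (_ | _)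
      · refine ⟨fun x hx y hy h => hL'.inj hx hy (by simpa using h), ?_⟩
        intro x hx y hy hxy
        rcases hx with rfl | rfl <;> rcases hy with rfl | rfl <;> first | exact le_rfl | tauto
      · exact hL'
    · intro x hx y hy hxy
      have hne : L x ≠ L y := fun h => hxy (hL'.inj hx hy h).le
      rcases lt_or_gt_of_ne hne with h | h
      · exact ⟨false, by simpa using h⟩
      · exact ⟨true, by simpa using h⟩

/-- Deleting an element `w` at most doubles the dimension: every incomparable pair lies outside
the up-set or outside the down-set of `w`. -/
theorem emb_of_delete [Finite P] (hn : 0 < n) (h1 : Emb n {x | x ∈ S ∧ ¬ w ≤ x})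
    (h2 : Emb n {x | x ∈ S ∧ ¬ x ≤ w}) : Emb (n + n) S := by
  classical
  obtain ⟨f, hf, hfr⟩ := h1
  obtain ⟨g, hg, hgr⟩ := h2
  obtain ⟨L, hL⟩ := exists_key P
  have hLlt : ∀ x y : P, x < y → L x < L y := fun x y h =>
    hL.lt (Set.mem_univ _) (Set.mem_univ _) h.le h.ne
  have hLinj : ∀ x y : P, x ≠ y → L x ≠ L y := fun x y h h' =>
    h (hL.inj (Set.mem_univ _) (Set.mem_univ _) h')
  have hF : ∀ i, ∃ F, IsKey S F ∧ (∀ x ∈ S, ∀ y ∈ S, w ≤ x → ¬ w ≤ y → F y < F x) ∧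
      (∀ x ∈ S, ∀ y ∈ S, w ≤ x → w ≤ y → L y < L x → F y < F x) ∧
      ∀ x ∈ S, ∀ y ∈ S, ¬ w ≤ x → ¬ w ≤ y → f i y < f i x → F y < F x := by
    intro i
    -- The up-set of w is put on top, ordered by L; below it the given key decides. The keys in `hG`
    -- dually put the down-set of w at the bottom.
    obtain ⟨F, hF, hlt⟩ := exists_key_of_lt (S := S)
      (fun x => toLex ((if w ≤ x then 1 else 0 : ℤ), if w ≤ x then L x else f i x)) (by
        intro x hx y hy hne h
        by_cases hwx : w ≤ x <;> by_cases hwy : w ≤ y <;> simp [hwx, hwy] at h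
        · exact hLinj x y hne h
        · exact hne ((hf i).inj ⟨hx, hwx⟩ ⟨hy, hwy⟩ h)) (by
        intro x hx y hy hxy
        rw [Prod.Lex.toLex_lt_toLex]
        by_cases hwx : w ≤ x
        · simp [hwx, hwx.trans hxy.le, hLlt x y hxy]
        · by_cases hwy : w ≤ y
          · simp [hwx, hwy]
          · simp [hwx, hwy, (hf i).lt (x := x) (y := y) ⟨hx, hwx⟩ ⟨hy, hwy⟩ hxy.le hxy.ne])
    refine ⟨F, hF, fun x hx y hy hwx hwy => hlt y hy x hx ?_,
      fun x hx y hy hwx hwy h => hlt y hy x hx ?_, fun x hx y hy hwx hwy h => hlt y hy x hx ?_⟩ <;>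
      rw [Prod.Lex.toLex_lt_toLex] <;> simp [hwx, hwy]
    · exact h
    · exact h
  have hG : ∀ i, ∃ F, IsKey S F ∧ (∀ x ∈ S, ∀ y ∈ S, ¬ x ≤ w → y ≤ w → F y < F x) ∧
      ∀ x ∈ S, ∀ y ∈ S, ¬ x ≤ w → ¬ y ≤ w → g i y < g i x → F y < F x := by
    intro i
    obtain ⟨F, hF, hlt⟩ := exists_key_of_lt (S := S)
      (fun x => toLex ((if x ≤ w then 0 else 1 : ℤ), if x ≤ w then L x else g i x)) (by
        intro x hx y hy hne h
        by_cases hwx : x ≤ w <;> by_cases hwy : y ≤ w <;> simp [hwx, hwy] at h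
        · exact hLinj x y hne h
        · exact hne ((hg i).inj ⟨hx, hwx⟩ ⟨hy, hwy⟩ h)) (by
        intro x hx y hy hxy
        rw [Prod.Lex.toLex_lt_toLex]
        by_cases hwy : y ≤ w
        · simp [hwy, hxy.le.trans hwy, hLlt x y hxy]
        · by_cases hwx : x ≤ w
          · simp [hwx, hwy]
          · simp [hwx, hwy, (hg i).lt (x := x) (y := y) ⟨hx, hwx⟩ ⟨hy, hwy⟩ hxy.le hxy.ne])
    refine ⟨F, hF, fun x hx y hy hwx hwy => hlt y hy x hx ?_,
      fun x hx y hy hwx hwy h => hlt y hy x hx ?_⟩ <;>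
      rw [Prod.Lex.toLex_lt_toLex] <;> simp [hwx, hwy]
    exact h
  choose F hFk hF1 hF2 hF3 using hF
  choose F' hGk hG1 hG2 using hG
  refine emb_of_fintype (ι := Fin n ⊕ Fin n) (by simp) (Sum.elim F F') ?_ ?_
  · rintro (i | i)
    · exact hFk i
    · exact hGk i
  · intro x hx y hy hxy
    let i₀ : Fin n := ⟨0, hn⟩
    by_cases hwx : w ≤ x
    · by_cases hwy : w ≤ y
      · have hxw : ¬ x ≤ w := fun h => hxy (h.trans hwy)
        by_cases hyw : y ≤ w
        · refine ⟨Sum.inl i₀, hF2 i₀ x hx y hy hwx hwy (hLlt y x ?_)⟩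
          exact lt_of_le_of_ne (hyw.trans hwx) fun h => hxy h.ge
        · obtain ⟨i, hi⟩ := hgr x ⟨hx, hxw⟩ y ⟨hy, hyw⟩ hxy
          exact ⟨Sum.inr i, hG2 i x hx y hy hxw hyw hi⟩
      · exact ⟨Sum.inl i₀, hF1 i₀ x hx y hy hwx hwy⟩
    · by_cases hwy : w ≤ y
      · have hxw : ¬ x ≤ w := fun h => hxy (h.trans hwy)
        by_cases hyw : y ≤ w
        · exact ⟨Sum.inr i₀, hG1 i₀ x hx y hy hxw hyw⟩
        · obtain ⟨i, hi⟩ := hgr x ⟨hx, hxw⟩ y ⟨hy, hyw⟩ hxy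
          exact ⟨Sum.inr i, hG2 i x hx y hy hxw hyw hi⟩
      · obtain ⟨i, hi⟩ := hfr x ⟨hx, hwx⟩ y ⟨hy, hwy⟩ hxy
        exact ⟨Sum.inl i, hF3 i x hx y hy hwx hwy hi⟩

/-- Apply `emb_of_delete` to the elements of W in turn. Its two parts, unlike S with w simply
removed, remain convex. -/
theorem emb_of_forall_avoiding [Finite P] (hn : 0 < n) (W : Finset P) : ∀ S : Set P,
    S.OrdConnected → (∀ T ⊆ S, T.OrdConnected → (∀ z ∈ T, z ∉ W) → Emb n T) →
    Emb (2 ^ W.card * n) S := by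
  classical
  induction W using Finset.induction_on with
  | empty =>
    intro S hS h
    simpa using h S le_rfl hS (by simp)
  | insert w W hw ih =>
    intro S hS h
    rw [Finset.card_insert_of_notMem hw, pow_succ, mul_comm _ 2, mul_assoc, two_mul]
    refine emb_of_delete (w := w) (by positivity) (ih _ ?_ ?_) (ih _ ?_ ?_)
    · refine ⟨fun x hx y hy z hz => ⟨hS.out hx.1 hy.1 hz, fun h => hy.2 (h.trans hz.2)⟩⟩
    · refine fun T hT hTc hTW => h T (fun z hz => (hT hz).1) hTc fun z hz hzW => ?_
      rcases Finset.mem_insert.1 hzW with rfl | hzW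
      · exact (hT hz).2 le_rfl
      · exact hTW z hz hzW
    · refine ⟨fun x hx y hy z hz => ⟨hS.out hx.1 hy.1 hz, fun h => hx.2 (hz.1.trans h)⟩⟩
    · refine fun T hT hTc hTW => h T (fun z hz => (hT hz).1) hTc fun z hz hzW => ?_
      rcases Finset.mem_insert.1 hzW with rfl | hzW
      · exact (hT hz).2 le_rfl
      · exact hTW z hz hzW

end Keys

/-! ### Dimension from blocks -/

section Blocks

variable {P : Type*} [PartialOrder P] {S T : Set P} {u : P → P} {r w : P} {n m : ℕ}

/-- The part of `S` that `u` sends to `b`. -/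
def tail (S : Set P) (u : P → P) (b : P) : Set P := {x | x ∈ S ∧ u x = b}

/-- `u` maps `S` idempotently into itself, and every relation between elements with different
images passes through these images. -/
structure Folds (S : Set P) (u : P → P) : Prop where
  maps : ∀ x ∈ S, u x ∈ S
  idem : ∀ x ∈ S, u (u x) = u x
  le : ∀ x ∈ S, ∀ y ∈ S, x ≤ y → u x = u y ∨ (x ≤ u x ∧ u x ≤ u y ∧ u y ≤ y)

theorem Folds.mem_core (hu : Folds S u) {x : P} (hx : x ∈ S) : u x ∈ core S u :=
  ⟨hu.maps x hx, hu.idem x hx⟩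

/-- By convexity, a relation in S is a chain of covers inside S. Each cover is contracted or lies in
the core, so a chain that changes its image enters the core at the first image and leaves it at the
last. -/
theorem IsRetraction.folds [Finite P] (hS : S.OrdConnected)
    (hu : IsRetraction (SimpleGraph.hasse P) S u) : Folds S u := by
  classical
  have := Fintype.ofFinite P
  let _ : LocallyFiniteOrder P := Fintype.toLocallyFiniteOrder
  refine ⟨hu.maps, hu.idem, fun x hx y hy hxy => ?_⟩
  have hxy' := le_iff_reflTransGen_covBy.1 hxy
  induction hxy' using Relation.ReflTransGen.head_induction_on with
  | refl => exact Or.inl rfl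
  | head hxz hzy ih =>
    rename_i x z
    have hzy' := le_iff_reflTransGen_covBy.2 hzy
    have hz : z ∈ S := hS.out hx hy ⟨hxz.le, hzy'⟩
    have ih := ih hz hzy'
    rcases hu.adj x hx z hz (Or.inl hxz) with h | ⟨h1, h2⟩
    · rcases ih with h' | ⟨h3, h4, h5⟩
      · exact Or.inl (h.trans h')
      · exact Or.inr ⟨by rw [h]; exact hxz.le.trans h3, by rwa [h], h5⟩
    · right
      rcases ih with h' | ⟨h3, h4, h5⟩
      · rw [← h', h2, h1]
        exact ⟨le_rfl, hxz.le, hzy'⟩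
      · refine ⟨h1.ge, ?_, h5⟩
        rw [h1]
        exact hxz.le.trans (h3.trans h4)

theorem Folds.ordConnected_tail (hS : S.OrdConnected) (hu : Folds S u) (b : P) :
    (tail S u b).OrdConnected := by
  refine ⟨fun x hx y hy z hz => ?_⟩
  have hzS := hS.out hx.1 hy.1 hz
  refine ⟨hzS, ?_⟩
  rcases hu.le x hx.1 z hzS hz.1 with h | ⟨h1, h2, h3⟩
  · rw [← h, hx.2]
  · rcases hu.le z hzS y hy.1 hz.2 with h' | ⟨h4, h5, h6⟩
    · rw [h', hy.2]
    · rw [hx.2] at h2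
      rw [hy.2] at h5
      exact le_antisymm h5 h2

theorem Folds.ordConnected_core (hS : S.OrdConnected) (hu : Folds S u) :
    (core S u).OrdConnected := by
  refine ⟨fun x hx y hy z hz => ?_⟩
  have hzS := hS.out hx.1 hy.1 hz
  refine ⟨hzS, ?_⟩
  rcases hu.le x hx.1 z hzS hz.1 with h | ⟨h1, h2, h3⟩
  · rcases hu.le z hzS y hy.1 hz.2 with h' | ⟨h4, h5, h6⟩
    · have hxy : x = y := by rw [← hx.2, h, h', hy.2]
      subst hxy
      have : z = x := le_antisymm hz.2 hz.1
      rw [this, hx.2]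
    · rw [← h, hx.2] at h4
      have : z = x := le_antisymm h4 hz.1
      rw [this, hx.2]
  · rcases hu.le z hzS y hy.1 hz.2 with h' | ⟨h4, h5, h6⟩
    · rw [h', hy.2] at h3
      have : z = y := le_antisymm hz.2 h3
      rw [this, hy.2]
    · exact le_antisymm h3 h4

/-- A realizer of the subposet on `S` by `n + 2` keys, one of which has the down-set of `r` as
an initial segment and another the up-set of `r` as a final segment. -/
def RootedEmb (n : ℕ) (S : Set P) (r : P) : Prop :=
  ∃ (f : Fin n → P → ℤ) (g h : P → ℤ), (∀ i, IsKey S (f i)) ∧ IsKey S g ∧ IsKey S h ∧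
    (∀ x ∈ S, ∀ y ∈ S, ¬ x ≤ y → (∃ i, f i y < f i x) ∨ g y < g x ∨ h y < h x) ∧
    (∀ x ∈ S, ∀ y ∈ S, x ≤ r → ¬ y ≤ r → g x < g y) ∧
    ∀ x ∈ S, ∀ y ∈ S, r ≤ x → ¬ r ≤ y → h y < h x

theorem RootedEmb.emb [Finite P] (h : RootedEmb n S r) : Emb (n + 2) S := by
  obtain ⟨f, g, h, hf, hg, hh, hr, -⟩ := h
  refine emb_of_fintype (ι := Fin n ⊕ Bool) (by simp)
    (Sum.elim f fun c => if c then g else h) ?_ ?_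
  · rintro (i | _ | _)
    · exact hf i
    · exact hh
    · exact hg
  · intro x hx y hy hxy
    rcases hr x hx y hy hxy with ⟨i, hi⟩ | h' | h'
    · exact ⟨Sum.inl i, hi⟩
    · exact ⟨Sum.inr true, h'⟩
    · exact ⟨Sum.inr false, h'⟩

/-- Keys of the tails, arranged along a key of the core. -/
theorem Folds.exists_lex_key [Finite P] (hu : Folds S u) {L : P → ℤ} (hL : IsKey (core S u) L)
    {g : P → P → ℤ} (hg : ∀ b ∈ core S u, IsKey (tail S u b) (g b)) :
    ∃ F, IsKey S F ∧ (∀ x ∈ S, ∀ y ∈ S, u x = u y → g (u x) y < g (u x) x → F y < F x) ∧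
      ∀ x ∈ S, ∀ y ∈ S, L (u y) < L (u x) → F y < F x := by
  obtain ⟨F, hF, hlt⟩ := exists_key_of_lt (S := S) (fun x => toLex (L (u x), g (u x) x)) (by
      intro x hx y hy hne h
      simp only [EmbeddingLike.apply_eq_iff_eq, Prod.mk.injEq] at h
      have huxy := hL.inj (hu.mem_core hx) (hu.mem_core hy) h.1
      rw [huxy] at h
      exact hne ((hg _ (hu.mem_core hy)).inj ⟨hx, huxy⟩ ⟨hy, rfl⟩ h.2)) (by
      intro x hx y hy hxy
      rw [Prod.Lex.toLex_lt_toLex]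
      by_cases huxy : u x = u y
      · right
        simp only [huxy, true_and]
        exact (hg _ (hu.mem_core hy)).lt ⟨hx, huxy⟩ ⟨hy, rfl⟩ hxy.le hxy.ne
      · left
        rcases hu.le x hx y hy hxy.le with h | ⟨-, h, -⟩
        · exact absurd h huxy
        · exact hL.lt (hu.mem_core hx) (hu.mem_core hy) h huxy)
  refine ⟨F, hF, fun x hx y hy huxy h => hlt y hy x hx ?_, fun x hx y hy h => hlt y hy x hx ?_⟩
  · rw [Prod.Lex.toLex_lt_toLex]
    right
    simp only [huxy] at h ⊢
    exact ⟨trivial, h⟩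
  · rw [Prod.Lex.toLex_lt_toLex]
    exact Or.inl h

/-- Keys of the tails, merged so that every `x` with `¬ x ≤ u x` is put above everything that
hangs on an element of the core above `u x`. -/
theorem Folds.exists_push_up [Finite P] (hu : Folds S u) (hr : r ∈ S) (hur : u r = r)
    {L₀ : P → ℤ} (hL₀ : IsKey (core S u) L₀)
    {g : P → P → ℤ} (hg : ∀ b ∈ core S u, IsKey (tail S u b) (g b))
    (hgr : ∀ b ∈ core S u, ∀ x ∈ tail S u b, ∀ y ∈ tail S u b, x ≤ b → ¬ y ≤ b → g b x < g b y) :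
    ∃ F, IsKey S F ∧ (∀ x ∈ S, ∀ y ∈ S, u x = u y → g (u x) y < g (u x) x → F y < F x) ∧
      (∀ x ∈ S, ∀ y ∈ S, x ≤ r → ¬ y ≤ r → F x < F y) ∧
      ∀ x ∈ S, ∀ y ∈ S, u x < u y → ¬ x ≤ u x → F y < F x := by
  classical
  -- Rearrange the key of the core so that the down-set of r comes first.
  obtain ⟨L, hL, hLr⟩ : ∃ L, IsKey (core S u) L ∧
      ∀ x ∈ core S u, ∀ y ∈ core S u, x ≤ r → ¬ y ≤ r → L x < L y := by
    obtain ⟨L, hL, hlt⟩ := exists_key_of_lt (S := core S u)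
      (fun x => toLex ((if x ≤ r then 0 else 1 : ℤ), L₀ x)) (by
        intro x hx y hy hne h
        simp only [EmbeddingLike.apply_eq_iff_eq, Prod.mk.injEq] at h
        exact hne (hL₀.inj hx hy h.2)) (by
        intro x hx y hy hxy
        rw [Prod.Lex.toLex_lt_toLex]
        have := hL₀.lt hx hy hxy.le hxy.ne
        by_cases hyr : y ≤ r
        · simp [hyr, hxy.le.trans hyr, this]
        · by_cases hxr : x ≤ r <;> simp [hyr, hxr, this])
    refine ⟨L, hL, fun x hx y hy hxr hyr => hlt x hx y hy ?_⟩
    rw [Prod.Lex.toLex_lt_toLex]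
    simp [hxr, hyr]
  -- Elements with x ≤ u x come first, in the order of L; the others come last, in the reverse order
  -- of L. This respects the order: if x < y have different images, then x ≤ u x.
  obtain ⟨F, hF, hlt⟩ := exists_key_of_lt (S := S)
    (fun x => toLex ((if x ≤ u x then 0 else 1 : ℤ),
      toLex ((if x ≤ u x then L (u x) else - L (u x)), g (u x) x))) (by
      intro x hx y hy hne h
      simp only [EmbeddingLike.apply_eq_iff_eq, Prod.mk.injEq] at h
      have hLxy : L (u x) = L (u y) := by
        by_cases hxu : x ≤ u x <;> by_cases hyu : y ≤ u y <;> simp [hxu, hyu] at h <;> exact h.1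
      have huxy := hL.inj (hu.mem_core hx) (hu.mem_core hy) hLxy
      have h3 := h.2.2
      rw [huxy] at h3
      exact hne ((hg _ (hu.mem_core hy)).inj ⟨hx, huxy⟩ ⟨hy, rfl⟩ h3)) (by
      intro x hx y hy hxy
      rw [Prod.Lex.toLex_lt_toLex]
      by_cases huxy : u x = u y
      · have h1 := (hg _ (hu.mem_core hy)).lt (x := x) (y := y) ⟨hx, huxy⟩ ⟨hy, rfl⟩ hxy.le hxy.ne
        by_cases hyu : y ≤ u y
        · have hxu : x ≤ u x := by rw [huxy]; exact hxy.le.trans hyu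
          simp only [huxy] at hxu
          simp [huxy, hyu, hxu, Prod.Lex.toLex_lt_toLex, h1]
        · by_cases hxu : x ≤ u x <;> simp only [huxy] at hxu <;>
            simp [huxy, hyu, hxu, Prod.Lex.toLex_lt_toLex, h1]
      · rcases hu.le x hx y hy hxy.le with h | ⟨hxu, hle, -⟩
        · exact absurd h huxy
        · have h1 := hL.lt (hu.mem_core hx) (hu.mem_core hy) hle huxy
          by_cases hyu : y ≤ u y <;> simp [hxu, hyu, Prod.Lex.toLex_lt_toLex, h1])
  refine ⟨F, hF, fun x hx y hy huxy h => hlt y hy x hx ?_,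
    fun x hx y hy hxr hyr => hlt x hx y hy ?_, fun x hx y hy hxy hxu => hlt y hy x hx ?_⟩ <;> rw [Prod.Lex.toLex_lt_toLex]
  · by_cases hyu : y ≤ u y
    · by_cases hxu : x ≤ u x
      · simp only [huxy] at hxu h
        simp [huxy, hyu, hxu, Prod.Lex.toLex_lt_toLex, h]
      · simp [hyu, hxu]
    · have hxu : ¬ x ≤ u x := fun hxu => by
        refine lt_asymm h (hgr (u x) (hu.mem_core hx) x ⟨hx, rfl⟩ y ⟨hy, huxy.symm⟩ hxu ?_)
        rwa [huxy]
      simp only [huxy] at hxu h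
      simp [huxy, hyu, hxu, Prod.Lex.toLex_lt_toLex, h]
  · obtain ⟨hxu, hxr'⟩ : x ≤ u x ∧ u x ≤ r := by
      rcases hu.le x hx r hr hxr with h | ⟨h1, h2, h3⟩
      · rw [h, hur]
        exact ⟨hxr, le_rfl⟩
      · exact ⟨h1, h2.trans hur.le⟩
    by_cases hyu : y ≤ u y
    · have := hLr _ (hu.mem_core hx) _ (hu.mem_core hy) hxr' fun h => hyr (hyu.trans h)
      simp [hxu, hyu, Prod.Lex.toLex_lt_toLex, this]
    · simp [hxu, hyu]
  · by_cases hyu : y ≤ u y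
    · simp [hxu, hyu]
    · have := hL.lt (hu.mem_core hx) (hu.mem_core hy) hxy.le hxy.ne
      simp [hxu, hyu, Prod.Lex.toLex_lt_toLex, this]

theorem IsKey.dual {f : P → ℤ} (hf : IsKey S f) : IsKey (P := Pᵒᵈ) S (fun x => - f x) :=
  ⟨fun _ hx _ hy h => hf.inj hx hy (neg_injective h),
    fun x hx y hy h => neg_le_neg (hf.mono y hy x hx h)⟩

theorem IsKey.of_dual {f : P → ℤ} (hf : IsKey (P := Pᵒᵈ) S f) : IsKey S (fun x => - f x) :=
  ⟨fun _ hx _ hy h => hf.inj hx hy (neg_injective h),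
    fun x hx y hy h => neg_le_neg (hf.mono y hy x hx h)⟩

theorem Folds.dual (hu : Folds S u) : Folds (P := Pᵒᵈ) S u := by
  refine ⟨hu.maps, hu.idem, fun x hx y hy hxy => ?_⟩
  rcases hu.le y hy x hx hxy with h | ⟨h1, h2, h3⟩
  · exact Or.inl h.symm
  · exact Or.inr ⟨h3, h2, h1⟩

/-- This is `Folds.exists_push_up` in the dual order, with all keys negated. -/
theorem Folds.exists_push_down [Finite P] (hu : Folds S u) (hr : r ∈ S) (hur : u r = r)
    {L₀ : P → ℤ} (hL₀ : IsKey (core S u) L₀)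
    {g : P → P → ℤ} (hg : ∀ b ∈ core S u, IsKey (tail S u b) (g b))
    (hgr : ∀ b ∈ core S u, ∀ x ∈ tail S u b, ∀ y ∈ tail S u b, b ≤ x → ¬ b ≤ y → g b y < g b x) :
    ∃ F, IsKey S F ∧ (∀ x ∈ S, ∀ y ∈ S, u x = u y → g (u x) y < g (u x) x → F y < F x) ∧
      (∀ x ∈ S, ∀ y ∈ S, r ≤ x → ¬ r ≤ y → F y < F x) ∧
      ∀ x ∈ S, ∀ y ∈ S, u x < u y → ¬ u y ≤ y → F y < F x := by
  have : Finite Pᵒᵈ := ‹Finite P›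
  obtain ⟨F, hF, h1, h2, h3⟩ := hu.dual.exists_push_up (P := Pᵒᵈ) (r := r) hr hur hL₀.dual
    (g := fun b x => - g b x) (fun b hb => (hg b hb).dual)
    (fun b hb x hx y hy hxb hyb => neg_lt_neg (hgr b hb x hx y hy hxb hyb))
  refine ⟨fun x => - F x, hF.of_dual, fun x hx y hy huxy h => ?_, fun x hx y hy hrx hry => ?_,
    fun x hx y hy hxy hyu => ?_⟩
  · refine neg_lt_neg (h1 y hy x hx huxy.symm (neg_lt_neg ?_))
    rwa [← huxy]
  · exact neg_lt_neg (h2 x hx y hy hrx hry)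
  · exact neg_lt_neg (h3 y hy x hx hxy hyu)

/-- Pairs with u x ≰ u y are reversed by the keys of the core. If u x < u y but x ≰ y, then x ≰ u x
or u y ≰ y, and pushing up or down reverses the pair. The two extra keys of the tails are reused for
this, so the count n + 2 does not grow with the depth of the block tree. -/
theorem Folds.rootedEmb [Finite P] (hn : 0 < n) (hu : Folds S u) (hr : r ∈ S) (hur : u r = r)
    (hcore : Emb n (core S u)) (htail : ∀ b ∈ core S u, RootedEmb n (tail S u b) b) :
    RootedEmb n S r := by
  obtain ⟨c, hc, hcr⟩ := hcore
  choose! f g h hf hg hh hrev hgr hhr using htail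
  choose F hF hF1 hF2 using fun i => hu.exists_lex_key (hc i) (g := fun b => f b i)
    (fun b hb => hf b hb i)
  obtain ⟨G, hG, hG1, hG2, hG3⟩ := hu.exists_push_up hr hur (hc ⟨0, hn⟩) hg hgr
  obtain ⟨H, hH, hH1, hH2, hH3⟩ := hu.exists_push_down hr hur (hc ⟨0, hn⟩) hh hhr
  refine ⟨F, G, H, hF, hG, hH, fun x hx y hy hxy => ?_, hG2, hH2⟩
  by_cases huxy : u x = u y
  · rcases hrev (u x) (hu.mem_core hx) x ⟨hx, rfl⟩ y ⟨hy, huxy.symm⟩ hxy with ⟨i, hi⟩ | h' | h'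
    · exact Or.inl ⟨i, hF1 i x hx y hy huxy hi⟩
    · exact Or.inr (Or.inl (hG1 x hx y hy huxy h'))
    · exact Or.inr (Or.inr (hH1 x hx y hy huxy h'))
  · by_cases hle : u x ≤ u y
    · have hlt := lt_of_le_of_ne hle huxy
      by_cases hxu : x ≤ u x
      · exact Or.inr (Or.inr (hH3 x hx y hy hlt fun h => hxy (hxu.trans (hle.trans h))))
      · exact Or.inr (Or.inl (hG3 x hx y hy hlt hxu))
    · obtain ⟨i, hi⟩ := hcr _ (hu.mem_core hx) _ (hu.mem_core hy) hle
      exact Or.inl ⟨i, hF2 i x hx y hy hi⟩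

theorem rootedEmb_of_blocks [Finite P] (hn : 2 ≤ n) : ∀ (m : ℕ) (S : Set P), S.ncard = m →
    S.OrdConnected → (∀ B ⊆ S, B.OrdConnected → B.Nontrivial →
      TwoConn (SimpleGraph.hasse P) B → Emb n B) → ∀ r ∈ S, RootedEmb n S r := by
  intro m
  induction m using Nat.strong_induction_on with
  | _ m ih =>
  rintro S rfl hS hB r hr
  by_cases hnt : S.Nontrivial
  swap
  · rw [Set.not_nontrivial_iff] at hnt
    have hk : IsKey S (fun _ => 0) := ⟨fun x hx y hy _ => hnt hx hy, fun _ _ _ _ _ => le_rfl⟩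
    exact ⟨fun _ _ => 0, fun _ => 0, fun _ => 0, fun _ => hk, hk, hk,
      fun x hx y hy h => absurd (hnt hx hy).le h,
      fun x hx y hy h h' => absurd ((hnt hy hx).le.trans h) h',
      fun x hx y hy h h' => absurd (h.trans (hnt hx hy).le) h'⟩
  obtain ⟨u, hu, hur, hcnt, hblock⟩ := exists_block_retraction (G := SimpleGraph.hasse P) hr hnt
  have hf := hu.folds hS
  refine hf.rootedEmb (by omega) hr hur ?_ fun b hb => ?_
  · rcases hblock with h2 | hT
    · obtain ⟨a, b, -, hab⟩ := Set.ncard_eq_two.1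
        (le_antisymm h2 ((Set.one_lt_ncard (Set.toFinite _)).2 hcnt))
      rw [hab]
      exact emb_pair a b hn
    · exact hB _ (fun z hz => hz.1) (hf.ordConnected_core hS) hcnt hT
  · have hsub : tail S u b ⊆ S := fun z hz => hz.1
    -- A second core element lies outside the tail at b, so every tail is smaller than S.
    obtain ⟨e, he, heb⟩ := hcnt.exists_ne b
    refine ih _ ?_ _ rfl (hf.ordConnected_tail hS b) (fun B hBS => hB B (hBS.trans hsub)) b hb
    refine Set.ncard_lt_ncard ⟨hsub, fun h => heb ?_⟩ (Set.toFinite _)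
    rw [← (h he.1).2, he.2]

/-- If every block of the cover graph induces a subposet of dimension at most `n`, then the whole
poset has dimension at most `n + 2`. -/
theorem emb_of_blocks [Finite P] (hn : 2 ≤ n) (hS : S.OrdConnected)
    (hB : ∀ B ⊆ S, B.OrdConnected → B.Nontrivial → TwoConn (SimpleGraph.hasse P) B → Emb n B) :
    Emb (n + 2) S := by
  rcases S.eq_empty_or_nonempty with rfl | ⟨r, hr⟩
  · exact emb_of_subsingleton Set.subsingleton_empty
  · exact (rootedEmb_of_blocks hn _ S rfl hS hB r hr).emb

end Blocks

/-! ### The bound on the dimension -/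

section Main

/-- A bound for the dimension of a 2-connected poset whose cover graph has no ladder with `k` rungs
as a minor and no ladder with `j` rungs rooted at some pair of elements. -/
def dimBound (k : ℕ) : ℕ → ℕ
  | 0 => 2
  | j + 1 => 2 ^ (k * k + 2) * (dimBound k j + 2)

theorem two_le_dimBound (k j : ℕ) : 2 ≤ dimBound k j := by
  cases j with
  | zero => exact le_rfl
  | succ j =>
    have : 1 ≤ 2 ^ (k * k + 2) := Nat.one_le_two_pow
    have := Nat.mul_le_mul_right (dimBound k j + 2) this
    rw [dimBound]
    omega

theorem dim_le_of_emb {P : Type*} [PartialOrder P] {n : ℕ} (h : Emb n (Set.univ : Set P)) : dim P ≤ n := by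
  obtain ⟨f, hf, hr⟩ := h
  let R : Set (P → P → Prop) := Set.range fun i x y => f i x ≤ f i y
  have hR : IsRealizer P R := by
    constructor
    · rintro _ ⟨i, rfl⟩
      exact ⟨fun x => le_rfl, fun x y z => le_trans,
        fun x y h1 h2 => (hf i).inj trivial trivial (le_antisymm h1 h2), fun x y => le_total _ _⟩
    · intro x y
      constructor
      · rintro hxy _ ⟨i, rfl⟩
        exact (hf i).mono x trivial y trivial hxy
      · intro h
        by_contra hxy
        obtain ⟨i, hi⟩ := hr x trivial y trivial hxy
        exact absurd (h _ ⟨i, rfl⟩) (not_le.2 hi)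
  have hcard : R.encard ≤ n := by
    refine (Set.image_univ (f := fun (i : Fin n) x y => f i x ≤ f i y) ▸
      Set.encard_image_le _ _).trans ?_
    simp
  have hdim : dim P ≤ R.encard := sInf_le ⟨R, hR, rfl⟩
  exact hdim.trans hcard

variable {P : Type*} [PartialOrder P] [Finite P] {k : ℕ}

/-- Induction on j, with the roots moving from x, y in D to the landing points in each 2-connected
piece that misses W. The case j = 0 is vacuous, since `RootedLadder` with no rungs always holds. -/
theorem emb_of_not_rootedLadder (hk : ¬ IsMinor (ladder k) (SimpleGraph.hasse P)) :
    ∀ (j : ℕ) (D : Set P), D.OrdConnected → TwoConn (SimpleGraph.hasse P) D →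
      ∀ x ∈ D, ∀ y ∈ D, x ≠ y → ¬ RootedLadder (SimpleGraph.hasse P) j D x y →
      Emb (dimBound k j) D := by
  intro j
  induction j with
  | zero => exact fun D _ _ x _ y _ _ h => absurd trivial h
  | succ j ih =>
    intro D hD hT x hx y hy hxy hno
    obtain ⟨W, hWc, hW⟩ := hT.exists_avoiding hk hx hy hxy
    have h2 := two_le_dimBound k j
    refine (emb_of_forall_avoiding (n := dimBound k j + 2) (by omega) W D hD ?_).mono
      (Nat.mul_le_mul_right _ (Nat.pow_le_pow_right (by norm_num) hWc))
    refine fun S hSD hS hSW => emb_of_blocks h2 hS fun B hBS hB hBn hBT => ?_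
    obtain ⟨H, hHD, hH, hxH, hyH, hHB⟩ := hW B (hBS.trans hSD) (hBT.sconn hBn.nonempty)
      fun z hz => hSW z (hBS hz)
    obtain ⟨x', hx', y', hy', hne, hgain⟩ := hT.exists_gain hx hy hxy (hBS.trans hSD) hBn hHD hH
      hxH hyH hHB
    exact ih B hB hBT x' hx' y' hy' hne fun h => hno (hgain j h)

theorem emb_univ_of_not_isMinor (hk : ¬ IsMinor (ladder k) (SimpleGraph.hasse P)) :
    Emb (dimBound k k + 2) (Set.univ : Set P) := by
  refine emb_of_blocks (two_le_dimBound k k) Set.ordConnected_univ fun B _ hB hBn hBT => ?_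
  obtain ⟨x, hx, y, hy, hxy⟩ := hBn
  exact emb_of_not_rootedLadder hk k B hB hBT x hx y hy hxy fun h => hk h.isMinor

end Main
end PosetLadder

theorem mainTheorem5 :
    (∀ k : ℕ, 1 ≤ k → ∃ d : ℕ, 1 ≤ d ∧
      ∀ (P : Type u) [PartialOrder P] [Finite P],
        ¬ PosetLadder.IsMinor (PosetLadder.ladder k) (SimpleGraph.hasse P) →
          PosetLadder.dim P ≤ (d : ℕ∞)) ∧
    (∀ k : ℕ, 1 ≤ k → PosetLadder.Unavoidable.{u} (PosetLadder.ladder k)) := by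
  refine ⟨fun k _ => ⟨PosetLadder.dimBound k k + 2, by omega, fun P _ _ h =>
    PosetLadder.dim_le_of_emb (PosetLadder.emb_univ_of_not_isMinor h)⟩,
    -- One more than the bound for ladder-free posets.
    fun k _ => ⟨PosetLadder.dimBound k k + 3, fun P _ _ h => ?_⟩⟩
  by_contra hno
  have h1 := h.trans (PosetLadder.dim_le_of_emb (PosetLadder.emb_univ_of_not_isMinor hno))
  have h2 : PosetLadder.dimBound k k + 3 ≤ PosetLadder.dimBound k k + 2 := by exact_mod_cast h1
  omega
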